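/- Let $\mathbb{T}=\mathbb{R}/\mathbb{Z}$ and consider, for $U=(u,v):[0,\infty)\times\mathbb{T}\to\mathbb{R}^2$, the system $$\partial_t u+\partial_x\Big(\frac{uv}{2}+v\Big)=0,\qquad \partial_t v+\partial_x\Big(u-\frac{v^2}{2}\Big)=0,$$ with flux $f(u,v)=\big(\frac{uv}{2}+v,\;u-\frac{v^2}{2}\big)$. There exists a nonempty connected open set $\mathcal{V}\subset\mathbb{R}^2$ such that: 1. On $\mathcal{V}$ the system is strictly hyperbolic, i.e. $Df(U)$ has real eigenvalues $\Lambda^-(U)<\Lambda^+(U)$ for $U\in\mathcal V$, with right eigenvectors $r_\pm(U)\neq 0$, the functions $\Lambda^\pm$ and $r_\pm$ being $C^\infty$ on $\mathcal{V}$; and both characteristic fields are genuinely nonlinear in $\mathcal{V}$, i.e. $\nabla\Lambda^-(U)\cdot r_-(U)\neq 0$ and $\nabla\Lambda^+(U)\cdot r_+(U)\neq0$ for all $U\in\mathcal{V}$. 2. For every open Euclidean ball $B\subset\mathcal{V}$ of positive radius there exist two distinct continuous functions $U_1,U_2:[0,\infty)\times\mathbb{T}\to B$ with $U_1(0,\cdot)=U_2(0,\cdot)$,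 each of which is a weak solution of the system, i.e. for $i=1,2$ and every compactly supported $C^1$ function $\varphi:\mathbb{R}\times\mathbb{T}\to\mathbb{R}$, $$\int_0^\infty\!\!\int_{\mathbb{T}}\big(U_i\,\partial_t\varphi+f(U_i)\,\partial_x\varphi\big)\,dx\,dt+\int_{\mathbb{T}}U_i(0,x)\,\varphi(0,x)\,dx=0.$$ -/

import Mathlib

open MeasureTheory Set
open scoped ContDiff

/-- The state space `ℝ²` with its Euclidean norm; a state `U` has components `u = U 0`, `v = U 1`. -/
abbrev State : Type := EuclideanSpace ℝ (Fin 2)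

/-- `(Λ, r)` is a smooth characteristic field on `V` of the system `∂ₜ U + ∂ₓ f(U) = 0`:
for every `U ∈ V`, `r U` is a right eigenvector of the Jacobian `Df(U)`, with eigenvalue `Λ U`. -/
structure IsCharacteristicField (f : State → State) (V : Set State)
    (Λ : State → ℝ) (r : State → State) : Prop where
  smooth_speed : ContDiffOn ℝ ∞ Λ V
  smooth_vector : ContDiffOn ℝ ∞ r V
  ne_zero : ∀ U ∈ V, r U ≠ 0
  eigen : ∀ U ∈ V, fderiv ℝ f U (r U) = Λ U • r U

/-- The field `(Λ, r)` is genuinely nonlinear in `V`: `∇Λ · r ≠ 0` at every point of `V`. -/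
def IsGenuinelyNonlinear (V : Set State) (Λ : State → ℝ) (r : State → State) : Prop :=
  ∀ U ∈ V, fderiv ℝ Λ U (r U) ≠ 0

/-- The derivative of a function on the torus `𝕋 = ℝ/ℤ` at the point `x`. -/
noncomputable def torusDeriv (g : UnitAddCircle → ℝ) (x : UnitAddCircle) : ℝ :=
  deriv (fun h : ℝ => g (x + (h : UnitAddCircle))) 0

/-- Test functions: compactly supported `C¹` functions on `ℝ × 𝕋`. A function on `ℝ × 𝕋` is `C¹`
when its lift to `ℝ × ℝ` (periodic in the second variable) is. -/
structure IsTestFunction (φ : ℝ → UnitAddCircle → ℝ) : Prop where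
  contDiff : ContDiff ℝ 1 (fun p : ℝ × ℝ => φ p.1 (p.2 : UnitAddCircle))
  compactSupport : HasCompactSupport (fun p : ℝ × UnitAddCircle => φ p.1 p.2)

/-- `u` is a weak solution on `[0, ∞) × 𝕋` of `∂ₜ u + ∂ₓ f(u) = 0` with initial value `u₀`:
`u` and `u₀` are bounded and measurable, and for every test function `φ`
`∫₀^∞ ∫_𝕋 (u φₜ + f(u) φₓ) dx dt + ∫_𝕋 u₀ φ(0, x) dx = 0`.
Only the values of `u` at times `t ≥ 0` matter. -/
structure IsWeakSolution (f : State → State) (u : ℝ → UnitAddCircle → State)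
    (u₀ : UnitAddCircle → State) : Prop where
  bounded : ∃ C : ℝ, ∀ t : ℝ, 0 ≤ t → ∀ x, ‖u t x‖ ≤ C
  measurable : AEStronglyMeasurable (fun p : ℝ × UnitAddCircle => u p.1 p.2)
    (volume.restrict (Ici (0 : ℝ) ×ˢ univ))
  bounded_init : ∃ C : ℝ, ∀ x, ‖u₀ x‖ ≤ C
  measurable_init : AEStronglyMeasurable u₀ volume
  weak : ∀ φ : ℝ → UnitAddCircle → ℝ, IsTestFunction φ →
    (∫ t in Ioi (0 : ℝ), ∫ x : UnitAddCircle,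
        (deriv (fun s => φ s x) t • u t x + torusDeriv (φ t) x • f (u t x)))
      + (∫ x : UnitAddCircle, φ 0 x • u₀ x) = 0

/-- `u` belongs to `C⁰([0, ∞) × 𝕋; B)`. -/
def IsContinuousInto (B : Set State) (u : ℝ → UnitAddCircle → State) : Prop :=
  ContinuousOn (fun p : ℝ × UnitAddCircle => u p.1 p.2) (Ici (0 : ℝ) ×ˢ univ) ∧
    ∀ t : ℝ, 0 ≤ t → ∀ x, u t x ∈ B

/-- The flux `f(u, v) = (uv/2 + v, u - v²/2)`. -/
noncomputable def exampleFlux (U : State) : State :=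
  !₂[U 0 * U 1 / 2 + U 1, U 0 - U 1 ^ 2 / 2]

/-! The proof is a one-dimensional convex integration near the origin, close to the line `v = 0`
where both characteristic fields degenerate linearly. Write the unknown as `(c₁, c₂) + ∂ₓ(p, s)`
with periodic potentials `p, s`. The integrated system then says that the residuals `residualU` and
`residualV` vanish, and a residual depending on `t` alone is harmless because `∂ₓ` kills it.

Add to `s` a wave `k⁻¹ a sin(kθ)`, `θ = x - σt`, and to `p` the same wave times `σ + v`, so that the
oscillation follows the eigenvector `(σ + v, 1)`, together with a second harmonic `(2k)⁻¹ (a²/4)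
sin(2kθ)`. As `k → ∞` the second residual moves by exactly `-a²/4`: the harmonic cancels the
oscillating part of `v²/2`. The first moves by `a²(σ + v)/4` plus errors of size `|a|` times
`speedDefect`, `a²|v|` and `|a|³`. All of these are small compared with the squared amplitude if `σ`
is nearly characteristic and `v`, `a` are small (`wave_algebra`, `exists_single_wave`).

A plane wave has constant speed whereas the characteristic speed varies, so the amplitude is split
by a quadratic partition of unity in the value of that speed (`exists_wave_family`). Adding the
pieces in succession moves the state along the eigenvector, which hardly changes the characteristic
speed because `∇Λ · r` is proportional to `v`.

The families of sign `±1` with amplitudes `A, B` shift the residuals by about `(A² - B²)/4` and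
`-(A² + B²)/4`. The first has either sign; the second is always nonpositive, and this is repaired by
the free function `κ(t)`. Hence an error of size `δ` is reduced to `δ/4` at the cost of moving the
state by `O(√δ)` (`IsSubsolution.exists_next`). The moves are summable, so the states converge
uniformly to a continuous weak solution that is constant for `t < 1`. The potentials move
arbitrarily little, so an initial bump survives and the limit differs from the constant solution
(`exists_nonconstant_flow`). Excluding `v = 0` from the state set, while staying near it, gives
genuine nonlinearity. -/

/-! ### Calculus of periodic functions of `(t, x)` supported in a time slab -/

/-- The time derivative of a function of `(t, x)`. -/
noncomputable def partialT (F : ℝ × ℝ → ℝ) (z : ℝ × ℝ) : ℝ := fderiv ℝ F z (1, 0)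

/-- The space derivative of a function of `(t, x)`. -/
noncomputable def partialX (F : ℝ × ℝ → ℝ) (z : ℝ × ℝ) : ℝ := fderiv ℝ F z (0, 1)

/-- Smooth functions of `(t, x)`, `1`-periodic in `x`. -/
structure IsSmoothPeriodic (F : ℝ × ℝ → ℝ) : Prop where
  smooth : ContDiff ℝ ∞ F
  periodic : ∀ t x, F (t, x + 1) = F (t, x)

/-- Smooth functions of `(t, x)`, `1`-periodic in `x` and vanishing for `|t - 3| > ρ`. -/
structure Admissible (ρ : ℝ) (F : ℝ × ℝ → ℝ) : Prop extends IsSmoothPeriodic F where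
  vanish : ∀ z : ℝ × ℝ, ρ < |z.1 - 3| → F z = 0

theorem ContDiff.partialT {F : ℝ × ℝ → ℝ} (hF : ContDiff ℝ ∞ F) : ContDiff ℝ ∞ (partialT F) :=
  (hF.fderiv_right (m := ∞) (by simp)).clm_apply contDiff_const

theorem ContDiff.partialX {F : ℝ × ℝ → ℝ} (hF : ContDiff ℝ ∞ F) : ContDiff ℝ ∞ (partialX F) :=
  (hF.fderiv_right (m := ∞) (by simp)).clm_apply contDiff_const

theorem fderiv_add_one_of_periodic {F : ℝ × ℝ → ℝ} (hF : ∀ t x, F (t, x + 1) = F (t, x))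
    (t x : ℝ) : fderiv ℝ F (t, x + 1) = fderiv ℝ F (t, x) := by
  have h : (fun z : ℝ × ℝ => F (z + (0, 1))) = F := by
    funext z
    obtain ⟨a, b⟩ := z
    simpa using hF a b
  have h2 := fderiv_comp_add_right (𝕜 := ℝ) (f := F) (x := (t, x)) (0, 1)
  rw [h] at h2
  rw [h2]
  simp

theorem fderiv_eq_zero_of_vanish {ρ : ℝ} {F : ℝ × ℝ → ℝ}
    (hF : ∀ z : ℝ × ℝ, ρ < |z.1 - 3| → F z = 0) (z : ℝ × ℝ) (hz : ρ < |z.1 - 3|) :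
    fderiv ℝ F z = 0 := by
  have hopen : IsOpen {w : ℝ × ℝ | ρ < |w.1 - 3|} :=
    isOpen_lt continuous_const (by fun_prop)
  have : F =ᶠ[nhds z] fun _ => (0 : ℝ) := by
    filter_upwards [hopen.mem_nhds hz] with w hw using hF w hw
  rw [this.fderiv_eq]
  simp

namespace IsSmoothPeriodic

variable {F G : ℝ × ℝ → ℝ}

theorem partialT (hF : IsSmoothPeriodic F) : IsSmoothPeriodic (partialT F) :=
  ⟨hF.smooth.partialT, fun t x => by
    simp only [_root_.partialT, fderiv_add_one_of_periodic hF.periodic]⟩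

theorem partialX (hF : IsSmoothPeriodic F) : IsSmoothPeriodic (partialX F) :=
  ⟨hF.smooth.partialX, fun t x => by
    simp only [_root_.partialX, fderiv_add_one_of_periodic hF.periodic]⟩

theorem add (hF : IsSmoothPeriodic F) (hG : IsSmoothPeriodic G) :
    IsSmoothPeriodic (fun z => F z + G z) :=
  ⟨hF.smooth.add hG.smooth, fun t x => by rw [hF.periodic, hG.periodic]⟩

theorem mul (hF : IsSmoothPeriodic F) (hG : IsSmoothPeriodic G) :
    IsSmoothPeriodic (fun z => F z * G z) :=
  ⟨hF.smooth.mul hG.smooth, fun t x => by rw [hF.periodic, hG.periodic]⟩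

theorem const (c : ℝ) : IsSmoothPeriodic (fun _ => c) :=
  ⟨contDiff_const, fun _ _ => rfl⟩

end IsSmoothPeriodic

namespace Admissible

variable {ρ : ℝ} {F G : ℝ × ℝ → ℝ}

theorem partialT (hF : Admissible ρ F) : Admissible ρ (partialT F) :=
  ⟨hF.toIsSmoothPeriodic.partialT, fun z hz => by
    simp [_root_.partialT, fderiv_eq_zero_of_vanish hF.vanish z hz]⟩

theorem partialX (hF : Admissible ρ F) : Admissible ρ (partialX F) :=
  ⟨hF.toIsSmoothPeriodic.partialX, fun z hz => by
    simp [_root_.partialX, fderiv_eq_zero_of_vanish hF.vanish z hz]⟩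

theorem add (hF : Admissible ρ F) (hG : Admissible ρ G) : Admissible ρ (fun z => F z + G z) :=
  ⟨hF.toIsSmoothPeriodic.add hG.toIsSmoothPeriodic, fun z hz => by
    rw [hF.vanish z hz, hG.vanish z hz, add_zero]⟩

theorem mul_right (hF : Admissible ρ F) (hG : IsSmoothPeriodic G) :
    Admissible ρ (fun z => F z * G z) :=
  ⟨hF.toIsSmoothPeriodic.mul hG, fun z hz => by rw [hF.vanish z hz, zero_mul]⟩

theorem mono {ρ' : ℝ} (hF : Admissible ρ F) (h : ρ ≤ ρ') : Admissible ρ' F :=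
  ⟨hF.toIsSmoothPeriodic, fun z hz => hF.vanish z (h.trans_lt hz)⟩

theorem exists_bound (hF : Admissible ρ F) : ∃ C, ∀ z, |F z| ≤ C := by
  have hc : IsCompact (Icc (3 - ρ) (3 + ρ) ×ˢ Icc (0 : ℝ) 1) := isCompact_Icc.prod isCompact_Icc
  obtain ⟨C, hC⟩ := hc.exists_bound_of_continuousOn hF.smooth.continuous.continuousOn
  refine ⟨max C 0, fun z => ?_⟩
  obtain ⟨t, x⟩ := z
  by_cases ht : ρ < |t - 3|
  · rw [hF.vanish (t, x) ht]
    simp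
  · have hper : Function.Periodic (fun y => F (t, y)) 1 := fun y => hF.periodic t y
    have hx : F (t, x) = F (t, Int.fract x) := by
      have := hper.sub_int_mul_eq (x := x) ⌊x⌋
      rw [mul_one] at this
      exact this.symm
    rw [hx]
    refine le_max_of_le_left (hC _ ⟨?_, ?_⟩)
    · have := abs_le.1 (not_lt.1 ht)
      exact ⟨by linarith [this.1], by linarith [this.2]⟩
    · exact ⟨Int.fract_nonneg x, (Int.fract_lt_one x).le⟩

end Admissible

/-! ### Adding a single plane wave -/

/-- The plane wave of frequency `k`, speed `σ` and slowly varying amplitude `g`. -/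
noncomputable def planeWave (k σ : ℝ) (g : ℝ × ℝ → ℝ) (z : ℝ × ℝ) : ℝ :=
  k⁻¹ * (g z * Real.sin (k * (z.2 - σ * z.1)))

theorem hasFDerivAt_planeWave {k σ : ℝ} {g : ℝ × ℝ → ℝ} (hg : ContDiff ℝ ∞ g) (z : ℝ × ℝ) :
    HasFDerivAt (planeWave k σ g) (k⁻¹ • (g z • (Real.cos (k * (z.2 - σ * z.1)) •
      (k • (ContinuousLinearMap.snd ℝ ℝ ℝ - σ • ContinuousLinearMap.fst ℝ ℝ ℝ))) +
      Real.sin (k * (z.2 - σ * z.1)) • fderiv ℝ g z)) z := by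
  have h1 : HasFDerivAt g (fderiv ℝ g z) z := (hg.differentiable (by simp) z).hasFDerivAt
  have h2 : HasFDerivAt (fun z : ℝ × ℝ => k * (z.2 - σ * z.1))
      (k • (ContinuousLinearMap.snd ℝ ℝ ℝ - σ • ContinuousLinearMap.fst ℝ ℝ ℝ)) z :=
    (hasFDerivAt_snd.sub (hasFDerivAt_fst.const_mul σ)).const_mul k
  exact (h1.mul h2.sin).const_mul k⁻¹

theorem partialX_planeWave {k σ : ℝ} (hk : k ≠ 0) {g : ℝ × ℝ → ℝ} (hg : ContDiff ℝ ∞ g)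
    (z : ℝ × ℝ) : partialX (planeWave k σ g) z = g z * Real.cos (k * (z.2 - σ * z.1)) +
      k⁻¹ * (Real.sin (k * (z.2 - σ * z.1)) * partialX g z) := by
  rw [partialX, (hasFDerivAt_planeWave hg z).fderiv]
  simp [partialX]
  field_simp

theorem partialT_planeWave {k σ : ℝ} (hk : k ≠ 0) {g : ℝ × ℝ → ℝ} (hg : ContDiff ℝ ∞ g)
    (z : ℝ × ℝ) : partialT (planeWave k σ g) z = -σ * (g z * Real.cos (k * (z.2 - σ * z.1))) +
      k⁻¹ * (Real.sin (k * (z.2 - σ * z.1)) * partialT g z) := by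
  rw [partialT, (hasFDerivAt_planeWave hg z).fderiv]
  simp [partialT]
  field_simp

theorem Admissible.planeWave {ρ k σ : ℝ} {g : ℝ × ℝ → ℝ} (hg : Admissible ρ g) (n : ℕ)
    (hk : k = n * (2 * Real.pi)) : Admissible ρ (planeWave k σ g) where
  smooth := by
    have := hg.smooth
    unfold _root_.planeWave
    fun_prop
  periodic t x := by
    have h : k * (x + 1 - σ * t) = k * (x - σ * t) + n * (2 * Real.pi) := by rw [hk]; ring
    simp only [_root_.planeWave, hg.periodic, h, Real.sin_add_nat_mul_two_pi]
  vanish z hz := by simp [_root_.planeWave, hg.vanish z hz]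

theorem partialX_add {F G : ℝ × ℝ → ℝ} (hF : ContDiff ℝ ∞ F) (hG : ContDiff ℝ ∞ G) (z : ℝ × ℝ) :
    partialX (fun w => F w + G w) z = partialX F z + partialX G z := by
  simp only [partialX]
  rw [fderiv_fun_add (hF.differentiable (by simp) z) (hG.differentiable (by simp) z)]
  simp

theorem partialT_add {F G : ℝ × ℝ → ℝ} (hF : ContDiff ℝ ∞ F) (hG : ContDiff ℝ ∞ G) (z : ℝ × ℝ) :
    partialT (fun w => F w + G w) z = partialT F z + partialT G z := by
  simp only [partialT]
  rw [fderiv_fun_add (hF.differentiable (by simp) z) (hG.differentiable (by simp) z)]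
  simp

theorem abs_planeWave_le {k σ B : ℝ} {g : ℝ × ℝ → ℝ} (hk : 0 < k) (z : ℝ × ℝ) (hg : |g z| ≤ B) :
    |planeWave k σ g z| ≤ k⁻¹ * B := by
  rw [planeWave, abs_mul, abs_mul, abs_of_pos (inv_pos.2 hk)]
  have h := Real.abs_sin_le_one (k * (z.2 - σ * z.1))
  have := mul_le_mul hg h (abs_nonneg _) ((abs_nonneg _).trans hg)
  rw [mul_one] at this
  exact mul_le_mul_of_nonneg_left this (inv_pos.2 hk).le

/-- The defect in the first component of the equation for a plane wave of speed `σ` in the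
direction `(σ + v, 1)`; it vanishes exactly when `σ` is a characteristic speed at `(u, v)`. -/
noncomputable def speedDefect (σ u v : ℝ) : ℝ := 1 + u / 2 - (σ - v / 2) * (σ + v)

/-- The residual of the first equation for the potential `(p, s)` over the constant state. -/
noncomputable def residualU (c₁ c₂ : ℝ) (p s : ℝ × ℝ → ℝ) (z : ℝ × ℝ) : ℝ :=
  partialT p z + ((c₁ + partialX p z) * (c₂ + partialX s z) / 2 + (c₂ + partialX s z))
    - (c₁ * c₂ / 2 + c₂)

/-- The residual of the second equation for the potential `(p, s)` over the constant state. -/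
noncomputable def residualV (c₁ c₂ : ℝ) (p s : ℝ × ℝ → ℝ) (z : ℝ × ℝ) : ℝ :=
  partialT s z + ((c₁ + partialX p z) - (c₂ + partialX s z) ^ 2 / 2) - (c₁ - c₂ ^ 2 / 2)

-- The exact algebra of one wave: `c` stands for the cosine of the phase, `2c² - 1` for its second
-- harmonic, `ν` for the inverse frequency, and the `eᵢ` for the terms in which the derivative falls
-- on an amplitude. In the second residual all oscillating terms cancel. In the first the
-- coefficient of `2c² - 1` reduces to `3a²v/8`, which is where closeness to `v = 0` enters.
set_option maxHeartbeats 600000 in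
theorem wave_algebra {u v a σ c B ν ε e₁ e₂ e₃ e₄ : ℝ} (hB : 1 ≤ B) (hν : 0 < ν) (hν1 : ν ≤ 1)
    (hε : 10 * B ^ 2 * ν ≤ ε) (hu : |u| ≤ B) (hv : |v| ≤ B) (hm : |σ + v| ≤ B) (ha : |a| ≤ B)
    (ham : |a * (σ + v)| ≤ B) (haa : |a ^ 2 / 4| ≤ B) (hc : |c| ≤ 1)
    (h₁ : |e₁| ≤ 2 * B * ν) (h₂ : |e₂| ≤ B * ν) (h₃ : |e₃| ≤ 2 * B * ν) (h₄ : |e₄| ≤ B * ν) :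
    |a * c + e₂| ≤ |a| + ε ∧
    |(a * (σ + v) * c + a ^ 2 / 4 * (2 * c ^ 2 - 1) + e₁) - (σ + v) * (a * c + e₂)|
      ≤ a ^ 2 / 4 + ε ∧
    |(-σ * (a * c) + e₄) + (a * (σ + v) * c + a ^ 2 / 4 * (2 * c ^ 2 - 1) + e₁)
      - ((v + (a * c + e₂)) ^ 2 / 2 - v ^ 2 / 2) + a ^ 2 / 4| ≤ ε ∧
    |(-σ * (a * (σ + v) * c + a ^ 2 / 4 * (2 * c ^ 2 - 1)) + e₃)
      + ((u + (a * (σ + v) * c + a ^ 2 / 4 * (2 * c ^ 2 - 1) + e₁)) * (v + (a * c + e₂)) / 2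
        - u * v / 2) + (a * c + e₂) - a ^ 2 * (σ + v) / 4|
      ≤ |a| * |speedDefect σ u v| + a ^ 2 * |v| + |a| ^ 3 + ε := by
  have hBν : 0 ≤ B * ν := by positivity
  have hBB : B * ν ≤ B ^ 2 * ν := by nlinarith
  have hC : |2 * c ^ 2 - 1| ≤ 1 := by
    have := sq_le_one_iff_abs_le_one c |>.2 hc
    rw [abs_le]; constructor <;> nlinarith [sq_nonneg c]
  set C := 2 * c ^ 2 - 1 with hCdef
  have hac : |a * c| ≤ |a| := by
    rw [abs_mul]; exact mul_le_of_le_one_right (abs_nonneg _) hc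
  have hvac : |v + a * c| ≤ 2 * B := (abs_add_le _ _).trans (by linarith)
  have hD : |a * (σ + v) * c + a ^ 2 / 4 * C| ≤ 2 * B := by
    refine (abs_add_le _ _).trans ?_
    rw [abs_mul _ c, abs_mul _ C]
    have := mul_le_mul ham hc (abs_nonneg _) (by linarith)
    have := mul_le_mul haa hC (abs_nonneg _) (by linarith)
    linarith
  have huD : |u + (a * (σ + v) * c + a ^ 2 / 4 * C)| ≤ 3 * B := (abs_add_le _ _).trans (by linarith)
  have hme : |(σ + v) * e₂| ≤ B * (B * ν) := by
    rw [abs_mul]; exact mul_le_mul hm h₂ (abs_nonneg _) (by linarith)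
  have hue : |(u + (a * (σ + v) * c + a ^ 2 / 4 * C)) * e₂| ≤ 3 * B * (B * ν) := by
    rw [abs_mul]; exact mul_le_mul huD h₂ (abs_nonneg _) (by linarith)
  have hve : |(v + a * c) * e₁| ≤ 2 * B * (2 * B * ν) := by
    rw [abs_mul]; exact mul_le_mul hvac h₁ (abs_nonneg _) (by linarith)
  have hve2 : |(v + a * c) * e₂| ≤ 2 * B * (B * ν) := by
    rw [abs_mul]; exact mul_le_mul hvac h₂ (abs_nonneg _) (by linarith)
  have hν2 : B * ν ≤ B := by nlinarith
  have hee : |e₁ * e₂| ≤ 2 * B * ν * B := by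
    rw [abs_mul]; exact mul_le_mul h₁ (h₂.trans hν2) (abs_nonneg _) (by nlinarith)
  have hee2 : |e₂ * e₂| ≤ B * ν * B := by
    rw [abs_mul]; exact mul_le_mul h₂ (h₂.trans hν2) (abs_nonneg _) (by nlinarith)
  have haC : |a ^ 2 / 4 * C| ≤ a ^ 2 / 4 := by
    rw [abs_mul, abs_of_nonneg (by positivity : (0 : ℝ) ≤ a ^ 2 / 4)]
    exact mul_le_of_le_one_right (by positivity) hC
  refine ⟨(abs_add_le _ _).trans (by linarith), ?_, ?_, ?_⟩
  · have : (a * (σ + v) * c + a ^ 2 / 4 * C + e₁) - (σ + v) * (a * c + e₂) =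
      a ^ 2 / 4 * C + (e₁ - (σ + v) * e₂) := by ring
    rw [this]
    refine (abs_add_le _ _).trans (add_le_add haC ((abs_sub _ _).trans ?_))
    linarith
  · have : (-σ * (a * c) + e₄) + (a * (σ + v) * c + a ^ 2 / 4 * C + e₁)
      - ((v + (a * c + e₂)) ^ 2 / 2 - v ^ 2 / 2) + a ^ 2 / 4 =
      e₄ + e₁ - (v + a * c) * e₂ - e₂ * e₂ / 2 := by rw [hCdef]; ring
    rw [this, abs_le]
    rw [abs_le] at h₄ h₁ hve2 hee2
    constructor <;> linarith
  · have : (-σ * (a * (σ + v) * c + a ^ 2 / 4 * C) + e₃)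
      + ((u + (a * (σ + v) * c + a ^ 2 / 4 * C + e₁)) * (v + (a * c + e₂)) / 2
        - u * v / 2) + (a * c + e₂) - a ^ 2 * (σ + v) / 4 =
      a * c * speedDefect σ u v + 3 / 8 * (a ^ 2 * v) * C + a ^ 3 / 8 * (c * C) +
      (e₃ + ((u + (a * (σ + v) * c + a ^ 2 / 4 * C)) * e₂ + (v + a * c) * e₁ + e₁ * e₂) / 2
        + e₂) := by rw [hCdef, speedDefect]; ring
    rw [this]
    have k1 : |a * c * speedDefect σ u v| ≤ |a| * |speedDefect σ u v| := by
      rw [abs_mul]; exact mul_le_mul_of_nonneg_right hac (abs_nonneg _)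
    have k2 : |3 / 8 * (a ^ 2 * v) * C| ≤ a ^ 2 * |v| := by
      rw [abs_mul, abs_mul, abs_mul, abs_of_nonneg (sq_nonneg a)]
      have h0 : 0 ≤ a ^ 2 * |v| := by positivity
      have := mul_le_of_le_one_right (a := |3 / 8| * (a ^ 2 * |v|)) (by positivity) hC
      have h38 : |(3 / 8 : ℝ)| = 3 / 8 := abs_of_pos (by norm_num)
      rw [h38] at *
      linarith
    have k3 : |a ^ 3 / 8 * (c * C)| ≤ |a| ^ 3 := by
      rw [abs_mul, abs_div, abs_pow, abs_mul]
      have h0 : 0 ≤ |a| ^ 3 := by positivity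
      have h1 : |c| * |C| ≤ 1 := mul_le_one₀ hc (abs_nonneg _) hC
      have h8 : |(8 : ℝ)| = 8 := abs_of_pos (by norm_num)
      rw [h8]
      have := mul_le_of_le_one_right (a := |a| ^ 3 / 8) (by positivity) h1
      linarith
    have k4 : |e₃ + ((u + (a * (σ + v) * c + a ^ 2 / 4 * C)) * e₂ + (v + a * c) * e₁ + e₁ * e₂) / 2
        + e₂| ≤ ε := by
      rw [abs_le]
      rw [abs_le] at h₃ h₂ hue hve hee
      constructor <;> linarith
    exact (abs_add_le _ _).trans (add_le_add ((abs_add_le _ _).trans (add_le_add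
      ((abs_add_le _ _).trans (add_le_add k1 k2)) k3)) k4)

theorem exists_common_bound (l : List (ℝ × ℝ → ℝ)) (hl : ∀ F ∈ l, ∃ C, ∀ z, |F z| ≤ C) :
    ∃ B : ℝ, 1 ≤ B ∧ ∀ F ∈ l, ∀ z, |F z| ≤ B := by
  induction l with
  | nil => exact ⟨1, le_rfl, by simp⟩
  | cons G l ih =>
    obtain ⟨B, hB1, hB⟩ := ih fun F hF => hl F (List.mem_cons_of_mem _ hF)
    obtain ⟨C, hC⟩ := hl G List.mem_cons_self
    refine ⟨max B C, hB1.trans (le_max_left _ _), fun F hF z => ?_⟩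
    rcases List.mem_cons.1 hF with rfl | hF
    · exact (hC z).trans (le_max_right _ _)
    · exact (hB F hF z).trans (le_max_left _ _)

theorem Admissible.exists_bound_const_add {ρ : ℝ} {F : ℝ × ℝ → ℝ} (hF : Admissible ρ F) (c : ℝ) :
    ∃ C, ∀ z, |c + F z| ≤ C := by
  obtain ⟨C, hC⟩ := hF.exists_bound
  exact ⟨|c| + C, fun z => (abs_add_le _ _).trans (by linarith [hC z])⟩

set_option maxHeartbeats 1000000 in
/-- Superposition of one plane wave of amplitude `a` and speed `σ` onto a potential `(p, s)`. -/
theorem exists_single_wave (c₁ c₂ : ℝ) {ρ : ℝ} {p s a : ℝ × ℝ → ℝ} (hp : Admissible ρ p)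
    (hs : Admissible ρ s) (ha : Admissible ρ a) (σ : ℝ) {ε : ℝ} (hε : 0 < ε) :
    ∃ p' s' : ℝ × ℝ → ℝ, Admissible ρ p' ∧ Admissible ρ s' ∧ ∀ z,
      |p' z - p z| ≤ ε ∧
      |partialX s' z - partialX s z| ≤ |a z| + ε ∧
      |(partialX p' z - partialX p z) -
        (σ + (c₂ + partialX s z)) * (partialX s' z - partialX s z)| ≤ a z ^ 2 / 4 + ε ∧
      |residualV c₁ c₂ p' s' z - residualV c₁ c₂ p s z + a z ^ 2 / 4| ≤ ε ∧
      |residualU c₁ c₂ p' s' z - residualU c₁ c₂ p s z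
          - a z ^ 2 * (σ + (c₂ + partialX s z)) / 4| ≤
        |a z| * |speedDefect σ (c₁ + partialX p z) (c₂ + partialX s z)|
          + a z ^ 2 * |c₂ + partialX s z| + |a z| ^ 3 + ε := by
  -- `g₁` puts the oscillation in the eigenvector direction `(σ + v, 1)`; `g₂ = a²/4` is the
  -- amplitude of the corrector at doubled frequency.
  set g₁ : ℝ × ℝ → ℝ := fun z => a z * (σ + (c₂ + partialX s z)) with hg₁
  set g₂ : ℝ × ℝ → ℝ := fun z => a z * (a z * 4⁻¹) with hg₂
  have Hg₁ : Admissible ρ g₁ := ha.mul_right ((IsSmoothPeriodic.const σ).add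
    ((IsSmoothPeriodic.const c₂).add hs.toIsSmoothPeriodic.partialX))
  have Hg₂ : Admissible ρ g₂ :=
    ha.mul_right (ha.toIsSmoothPeriodic.mul (IsSmoothPeriodic.const 4⁻¹))
  obtain ⟨B, hB1, hB⟩ := exists_common_bound [g₁, partialX g₁, partialT g₁, g₂, partialX g₂,
    partialT g₂, a, partialX a, partialT a, fun z => c₁ + partialX p z,
    fun z => c₂ + partialX s z, fun z => σ + c₂ + partialX s z] (by
      simp only [List.mem_cons, List.not_mem_nil, or_false, forall_eq_or_imp, forall_eq]
      exact ⟨Hg₁.exists_bound, Hg₁.partialX.exists_bound, Hg₁.partialT.exists_bound,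
        Hg₂.exists_bound, Hg₂.partialX.exists_bound, Hg₂.partialT.exists_bound,
        ha.exists_bound, ha.partialX.exists_bound, ha.partialT.exists_bound,
        hp.partialX.exists_bound_const_add _, hs.partialX.exists_bound_const_add _,
        hs.partialX.exists_bound_const_add _⟩)
  simp only [List.mem_cons, List.not_mem_nil, or_false, forall_eq_or_imp, forall_eq] at hB
  obtain ⟨h1, h2, h3, h4, h5, h6, h7, h8, h9, hu, hv, hm⟩ := hB
  -- The summand `1` gives `k⁻¹ ≤ 1`, the other gives `10 B² k⁻¹ ≤ ε`; an integer multiple of `2π`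
  -- keeps the wave `1`-periodic in `x`.
  obtain ⟨n, hn⟩ := exists_nat_gt (1 + 10 * B ^ 2 / ε)
  have hq : 0 ≤ 10 * B ^ 2 / ε := by positivity
  have hnpos : (0 : ℝ) < n := by linarith
  set k : ℝ := n * (2 * Real.pi) with hk
  have hkn : (n : ℝ) ≤ k := by
    rw [hk]; nlinarith [Real.pi_gt_three]
  have hkpos : 0 < k := hnpos.trans_le hkn
  have hν : 0 < k⁻¹ := inv_pos.2 hkpos
  have hν1 : k⁻¹ ≤ 1 := inv_le_one_of_one_le₀ (by linarith)
  have hνε : 10 * B ^ 2 * k⁻¹ ≤ ε := by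
    rw [← div_eq_mul_inv, div_le_iff₀ hkpos]
    have : 10 * B ^ 2 / ε ≤ k := by linarith
    rw [div_le_iff₀ hε] at this
    linarith
  have hk2 : 2 * k = ((2 * n : ℕ) : ℝ) * (2 * Real.pi) := by rw [hk]; push_cast; ring
  have hν2 : (2 * k)⁻¹ = k⁻¹ / 2 := by rw [mul_inv]; ring
  have W₁ := Hg₁.planeWave (σ := σ) n hk
  have W₂ := Hg₂.planeWave (σ := σ) (2 * n) hk2
  have W₃ := ha.planeWave (σ := σ) n hk
  refine ⟨fun z => p z + (planeWave k σ g₁ z + planeWave (2 * k) σ g₂ z),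
    fun z => s z + planeWave k σ a z, hp.add (W₁.add W₂), hs.add W₃, fun z => ?_⟩
  have b1 := h1 z
  have b4 := h4 z
  have bm : |σ + (c₂ + partialX s z)| ≤ B := by rw [← add_assoc]; exact hm z
  have hsin (k' : ℝ) {h e : ℝ} (hk' : 0 < k') (he : |h| ≤ B) :
      |k'⁻¹ * (Real.sin e * h)| ≤ B * k'⁻¹ := by
    rw [abs_mul, abs_mul, abs_of_pos (inv_pos.2 hk'), mul_comm B]
    refine mul_le_mul_of_nonneg_left ?_ (inv_pos.2 hk').le
    have := mul_le_mul (Real.abs_sin_le_one e) he (abs_nonneg _) zero_le_one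
    linarith
  have hcos : Real.cos (2 * k * (z.2 - σ * z.1)) = 2 * Real.cos (k * (z.2 - σ * z.1)) ^ 2 - 1 := by
    rw [← Real.cos_two_mul]; congr 1; ring
  have hBk : 0 ≤ B * k⁻¹ := by positivity
  have two (h h' e e' : ℝ) (he : |h| ≤ B) (he' : |h'| ≤ B) :
      |k⁻¹ * (Real.sin e * h) + (2 * k)⁻¹ * (Real.sin e' * h')| ≤ 2 * B * k⁻¹ := by
    refine (abs_add_le _ _).trans ?_
    have h1 := hsin k (e := e) hkpos he
    have h2 := hsin (2 * k) (e := e') (by linarith) he'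
    rw [hν2] at h2 ⊢
    linarith
  have key := wave_algebra (σ := σ) (c := Real.cos (k * (z.2 - σ * z.1))) hB1 hν hν1 hνε (hu z)
    (hv z) bm (h7 z) b1
    (by have : a z ^ 2 / 4 = g₂ z := by simp only [hg₂]; ring
        rw [this]; exact b4) (Real.abs_cos_le_one _)
    (two _ _ (k * (z.2 - σ * z.1)) (2 * k * (z.2 - σ * z.1)) (h2 z) (h5 z))
    (hsin k (e := k * (z.2 - σ * z.1)) hkpos (h8 z))
    (two _ _ (k * (z.2 - σ * z.1)) (2 * k * (z.2 - σ * z.1)) (h3 z) (h6 z))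
    (hsin k (e := k * (z.2 - σ * z.1)) hkpos (h9 z))
  have ex : partialX (fun z => p z + (planeWave k σ g₁ z + planeWave (2 * k) σ g₂ z)) z =
      partialX p z + (a z * (σ + (c₂ + partialX s z)) * Real.cos (k * (z.2 - σ * z.1))
        + a z ^ 2 / 4 * (2 * Real.cos (k * (z.2 - σ * z.1)) ^ 2 - 1)
        + (k⁻¹ * (Real.sin (k * (z.2 - σ * z.1)) * partialX g₁ z) +
          (2 * k)⁻¹ * (Real.sin (2 * k * (z.2 - σ * z.1)) * partialX g₂ z))) := by
    rw [partialX_add hp.smooth (W₁.add W₂).smooth, partialX_add W₁.smooth W₂.smooth,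
      partialX_planeWave hkpos.ne' Hg₁.smooth, partialX_planeWave (by positivity) Hg₂.smooth, hcos]
    simp only [hg₁, hg₂]
    ring
  have et : partialT (fun z => p z + (planeWave k σ g₁ z + planeWave (2 * k) σ g₂ z)) z =
      partialT p z + (-σ * (a z * (σ + (c₂ + partialX s z)) * Real.cos (k * (z.2 - σ * z.1))
        + a z ^ 2 / 4 * (2 * Real.cos (k * (z.2 - σ * z.1)) ^ 2 - 1))
        + (k⁻¹ * (Real.sin (k * (z.2 - σ * z.1)) * partialT g₁ z) +
          (2 * k)⁻¹ * (Real.sin (2 * k * (z.2 - σ * z.1)) * partialT g₂ z))) := by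
    rw [partialT_add hp.smooth (W₁.add W₂).smooth, partialT_add W₁.smooth W₂.smooth,
      partialT_planeWave hkpos.ne' Hg₁.smooth, partialT_planeWave (by positivity) Hg₂.smooth, hcos]
    simp only [hg₁, hg₂]
    ring
  have sx : partialX (fun z => s z + planeWave k σ a z) z =
      partialX s z + (a z * Real.cos (k * (z.2 - σ * z.1)) +
        k⁻¹ * (Real.sin (k * (z.2 - σ * z.1)) * partialX a z)) := by
    rw [partialX_add hs.smooth W₃.smooth, partialX_planeWave hkpos.ne' ha.smooth]
  have stt : partialT (fun z => s z + planeWave k σ a z) z =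
      partialT s z + (-σ * (a z * Real.cos (k * (z.2 - σ * z.1))) +
        k⁻¹ * (Real.sin (k * (z.2 - σ * z.1)) * partialT a z)) := by
    rw [partialT_add hs.smooth W₃.smooth, partialT_planeWave hkpos.ne' ha.smooth]
  refine ⟨?_, ?_, ?_, ?_, ?_⟩
  · rw [add_sub_cancel_left]
    refine (abs_add_le _ _).trans ?_
    have h1 := abs_planeWave_le (σ := σ) hkpos z b1
    have h2 := abs_planeWave_le (σ := σ) (by positivity : 0 < 2 * k) z b4
    rw [hν2] at h2
    have : B * k⁻¹ ≤ B ^ 2 * k⁻¹ := by nlinarith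
    linarith
  · rw [sx, add_sub_cancel_left]
    exact key.1
  · rw [ex, sx, add_sub_cancel_left, add_sub_cancel_left]
    exact key.2.1
  · refine (congrArg abs ?_).trans_le key.2.2.1
    simp only [residualV]
    rw [ex, sx, stt]
    ring
  · refine (congrArg abs ?_).trans_le key.2.2.2
    simp only [residualU]
    rw [ex, sx, et]
    ring

/-! ### A quadratic partition of unity -/

/-- A smooth quadratic partition of unity on the line, subordinate to the intervals
`(j, j + 2)`. -/
noncomputable def quadPartition (j : ℕ) (y : ℝ) : ℝ :=
  Real.sin (Real.pi / 2 * Real.smoothTransition (y - j)) *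
    Real.cos (Real.pi / 2 * Real.smoothTransition (y - j - 1))

theorem contDiff_quadPartition (j : ℕ) : ContDiff ℝ ∞ (quadPartition j) := by
  have h : ContDiff ℝ ∞ Real.smoothTransition := Real.smoothTransition.contDiff
  have h1 : ContDiff ℝ ∞ fun y : ℝ => Real.smoothTransition (y - j) := h.comp (by fun_prop)
  have h2 : ContDiff ℝ ∞ fun y : ℝ => Real.smoothTransition (y - j - 1) := h.comp (by fun_prop)
  exact (Real.contDiff_sin.comp (contDiff_const.mul h1)).mul
    (Real.contDiff_cos.comp (contDiff_const.mul h2))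

theorem abs_quadPartition_le (j : ℕ) (y : ℝ) : |quadPartition j y| ≤ 1 := by
  rw [quadPartition, abs_mul]
  exact mul_le_one₀ (Real.abs_sin_le_one _) (abs_nonneg _) (Real.abs_cos_le_one _)

theorem quadPartition_support {j : ℕ} {y : ℝ} (h : quadPartition j y ≠ 0) :
    (j : ℝ) < y ∧ y < j + 2 := by
  constructor
  · by_contra hy
    apply h
    rw [quadPartition, Real.smoothTransition.zero_of_nonpos (by linarith)]
    simp
  · by_contra hy
    apply h
    rw [quadPartition, Real.smoothTransition.one_of_one_le (x := y - j - 1) (by linarith)]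
    simp

/-- Consecutive transitions do not overlap: either the later one has not begun, so the cosine is
`1`, or the earlier one is complete, so the sine is `1`. Hence the squares telescope. Squares are
what must sum to `1`, since a wave acts on the residual through the square of its amplitude. -/
theorem quadPartition_sq (j : ℕ) (y : ℝ) : quadPartition j y ^ 2 =
    Real.sin (Real.pi / 2 * Real.smoothTransition (y - j)) ^ 2 -
    Real.sin (Real.pi / 2 * Real.smoothTransition (y - (j + 1 : ℕ))) ^ 2 := by
  have e : y - ((j + 1 : ℕ) : ℝ) = y - j - 1 := by push_cast; ring
  rw [e, quadPartition, mul_pow, Real.cos_sq']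
  rcases le_total (y - j) 1 with h | h
  · rw [Real.smoothTransition.zero_of_nonpos (x := y - j - 1) (by linarith)]
    simp
  · rw [Real.smoothTransition.one_of_one_le h]
    simp

theorem sum_quadPartition_sq {N : ℕ} {y : ℝ} (h1 : 1 ≤ y) (hN : y ≤ N) :
    ∑ j ∈ Finset.range N, quadPartition j y ^ 2 = 1 := by
  simp only [quadPartition_sq]
  rw [Finset.sum_range_sub' (fun j : ℕ =>
    Real.sin (Real.pi / 2 * Real.smoothTransition (y - j)) ^ 2)]
  rw [Real.smoothTransition.one_of_one_le (x := y - ((0 : ℕ) : ℝ)) (by simpa using h1),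
    Real.smoothTransition.zero_of_nonpos (x := y - N) (by linarith)]
  simp

/-- The condition `j < y < j + 2` leaves only the indices `⌊y⌋` and `⌊y⌋ - 1`, so the bound does not
depend on the number of waves. -/
theorem sum_abs_quadPartition_le (N : ℕ) (y : ℝ) :
    ∑ j ∈ Finset.range N, |quadPartition j y| ≤ 2 := by
  classical
  have hsub : ∀ j ∈ Finset.range N, j ∉ ({⌊y⌋₊, ⌊y⌋₊ - 1} : Finset ℕ) →
      |quadPartition j y| = 0 := by
    intro j _ hj
    rw [abs_eq_zero]
    by_contra hne
    obtain ⟨h1, h2⟩ := quadPartition_support hne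
    apply hj
    have hy : 0 ≤ y := (Nat.cast_nonneg j).trans h1.le
    have h3 : j ≤ ⌊y⌋₊ := Nat.le_floor h1.le
    have h4 : ⌊y⌋₊ < j + 2 := by
      rw [Nat.floor_lt hy]; push_cast; exact h2
    simp only [Finset.mem_insert, Finset.mem_singleton]
    omega
  have h0 : ∑ j ∈ Finset.range N, |quadPartition j y| ≤
      ∑ j ∈ ({⌊y⌋₊, ⌊y⌋₊ - 1} : Finset ℕ), |quadPartition j y| := by
    rw [← Finset.sum_filter_of_ne (p := fun j => j ∈ ({⌊y⌋₊, ⌊y⌋₊ - 1} : Finset ℕ))]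
    · exact Finset.sum_le_sum_of_subset_of_nonneg
        (fun j hj => (Finset.mem_filter.1 hj).2) fun _ _ _ => abs_nonneg _
    · intro j hj hne
      by_contra h
      exact hne (hsub j hj h)
  refine h0.trans ((Finset.sum_le_card_nsmul _ _ 1 fun j _ => abs_quadPartition_le j y).trans ?_)
  have := Finset.card_le_two (a := ⌊y⌋₊) (b := ⌊y⌋₊ - 1)
  rw [nsmul_eq_mul, mul_one]
  exact_mod_cast this

/-! ### Characteristic speeds near the origin -/

/-- The discriminant of the characteristic polynomial of the Jacobian of the flux. -/
noncomputable def discriminant (u v : ℝ) : ℝ := 9 * v ^ 2 / 4 + 2 * u + 4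

/-- The characteristic speed of sign `s = ±1`. -/
noncomputable def charSpeed (s u v : ℝ) : ℝ := (-v / 2 + s * √(discriminant u v)) / 2

theorem abs_sqrt_discriminant_sub_two_le {e u v : ℝ} (he : e ≤ 1 / 100) (hu : |u| ≤ e)
    (hv : |v| ≤ e) : |√(discriminant u v) - 2| ≤ 5 / 4 * e := by
  have hu' := abs_le.1 hu
  have hv' := abs_le.1 hv
  have he0 : 0 ≤ e := (abs_nonneg u).trans hu
  have hv2 : v ^ 2 ≤ e ^ 2 := sq_le_sq' hv'.1 hv'.2
  have hv0 := sq_nonneg v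
  have he2 : e ^ 2 ≤ e / 100 := by nlinarith
  rw [abs_le]
  constructor
  · have : 2 - 5 / 4 * e ≤ √(discriminant u v) := by
      apply Real.le_sqrt_of_sq_le
      rw [discriminant]
      nlinarith [hu'.1]
    linarith
  · have : √(discriminant u v) ≤ 2 + 5 / 4 * e := by
      rw [Real.sqrt_le_left (by linarith), discriminant]
      nlinarith [hu'.2]
    linarith

theorem abs_charSpeed_sub_le {s e u v : ℝ} (hs : s = 1 ∨ s = -1) (he : e ≤ 1 / 100)
    (hu : |u| ≤ e) (hv : |v| ≤ e) : |charSpeed s u v - s| ≤ e := by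
  have h := abs_le.1 (abs_sqrt_discriminant_sub_two_le he hu hv)
  have hv' := abs_le.1 hv
  rw [charSpeed, abs_le]
  rcases hs with rfl | rfl <;> constructor <;> linarith [h.1, h.2, hv'.1, hv'.2]

theorem discriminant_pos {e u v : ℝ} (he : e ≤ 1 / 100) (hu : |u| ≤ e) :
    0 < discriminant u v := by
  have hu' := abs_le.1 hu
  rw [discriminant]
  nlinarith [sq_nonneg v, hu'.1]

/-- `speedDefect` is minus the characteristic polynomial in `σ`. Near the origin its roots are close
to `±1`, so proximity to one root bounds the defect while the other factor stays bounded. -/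
theorem speedDefect_eq {s σ u v : ℝ} (hs : s = 1 ∨ s = -1) (hd : 0 ≤ discriminant u v) :
    speedDefect σ u v = -((σ - charSpeed s u v) * (σ - charSpeed (-s) u v)) := by
  have h := Real.sq_sqrt hd
  have hss : s ^ 2 = 1 := by rcases hs with rfl | rfl <;> norm_num
  have : s ^ 2 * √(discriminant u v) ^ 2 = discriminant u v := by rw [hss, h, one_mul]
  have h2 : discriminant u v = 9 * v ^ 2 / 4 + 2 * u + 4 := rfl
  simp only [speedDefect, charSpeed]
  linear_combination (-1 / 4) * this - (1 / 4) * h2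

theorem abs_speedDefect_le {s σ e h u v : ℝ} (hs : s = 1 ∨ s = -1) (he : e ≤ 1 / 100)
    (hh : h ≤ e) (hu : |u| ≤ e) (hv : |v| ≤ e) (hσ : |σ - charSpeed s u v| ≤ h) :
    |speedDefect σ u v| ≤ 4 * h := by
  rw [speedDefect_eq hs (discriminant_pos he hu).le, abs_neg, abs_mul]
  have h1 := abs_le.1 (abs_charSpeed_sub_le hs he hu hv)
  have hs' : -s = 1 ∨ -s = -1 := by rcases hs with rfl | rfl <;> simp
  have h2 := abs_le.1 (abs_charSpeed_sub_le hs' he hu hv)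
  have h3 := abs_le.1 hσ
  have h4 : |σ - charSpeed (-s) u v| ≤ 4 := by
    rw [abs_le]
    rcases hs with rfl | rfl <;> constructor <;> linarith [h1.1, h1.2, h2.1, h2.2, h3.1, h3.2]
  have := mul_le_mul hσ h4 (abs_nonneg _) ((abs_nonneg _).trans hσ)
  linarith

/-! ### Superposing the waves of one characteristic family -/

/-- Approximate linear degeneracy: under a displacement `(du, dv)` near the direction `(s, 1)`, the
first-order terms `du/2 - σ dv/2` almost cancel, and the remainder is `dv` times a quantity of order
`e`. Waves already added therefore do not spoil the speed of the next one. -/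
theorem abs_speedDefect_add_le {s σ e M u v du dv : ℝ} (he : 0 ≤ e) (hM : 0 ≤ M)
    (hσ : |σ - s| ≤ 2 * e) (h0 : |speedDefect σ u v| ≤ e * M) (hd : |du - s * dv| ≤ 16 * (e * M))
    (hdv : |dv| ≤ 3 * M) (hv : |v| ≤ e) (hv' : |v + dv| ≤ 4 * e) :
    |speedDefect σ (u + du) (v + dv)| ≤ 20 * (e * M) := by
  have e1 : speedDefect σ (u + du) (v + dv) = speedDefect σ u v + (du - s * dv) / 2
      - (σ - s) * dv / 2 + dv * ((v + dv) + v) / 2 := by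
    simp only [speedDefect]; ring
  have k1 : |(σ - s) * dv| ≤ 2 * e * (3 * M) := by
    rw [abs_mul]; exact mul_le_mul hσ hdv (abs_nonneg _) (by linarith)
  have k2 : |dv * ((v + dv) + v)| ≤ 3 * M * (5 * e) := by
    rw [abs_mul]
    exact mul_le_mul hdv ((abs_add_le _ _).trans (by linarith)) (abs_nonneg _) (by linarith)
  have hem : 0 ≤ e * M := mul_nonneg he hM
  rw [e1, abs_le]
  rw [abs_le] at k1 k2 h0 hd
  constructor <;> linarith [k1.1, k1.2, k2.1, k2.2, h0.1, h0.2, hd.1, hd.2]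

/-- Replaces the varying direction `σ + v` by the fixed sign `s`. Using `a² ≤ M|a|`, the errors are
written linearly in `|a|` with the small factor `e M`; the sum over a family is then controlled by
the sum of the `|a j|`, whatever the number of waves. -/
theorem wave_step_algebra {a σ s v P du dv r e M ε : ℝ} (he : 0 ≤ e) (hMe : M ≤ e)
    (haM : |a| ≤ M) (hσ7 : |σ + v - s| ≤ 7)
    (hσ : a ≠ 0 → |σ + v - s| ≤ 6 * e ∧ |P| ≤ 20 * (e * M)) (hv : |v| ≤ 4 * e) (hε : 0 ≤ ε)
    (hdv : |dv| ≤ |a| + ε) (hdu : |du - (σ + v) * dv| ≤ a ^ 2 / 4 + ε)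
    (hr : |r - a ^ 2 * (σ + v) / 4| ≤ |a| * |P| + a ^ 2 * |v| + |a| ^ 3 + ε) :
    |du - s * dv| ≤ a ^ 2 / 4 + 7 * e * |a| + 15 * ε ∧
    |r - s * a ^ 2 / 4| ≤ 30 * (e * M) * |a| + ε := by
  -- Where `a` vanishes nothing is known about how close `σ` is to characteristic, but only errors
  -- of size `ε` remain and the crude bound `7` suffices.
  by_cases ha : a = 0
  · subst ha
    simp only [abs_zero, zero_add, ne_eq, OfNat.ofNat_ne_zero, not_false_eq_true, zero_pow, zero_div,
      zero_mul, mul_zero, sub_zero] at *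
    refine ⟨?_, hr⟩
    have h1 : |(σ + v - s) * dv| ≤ 7 * ε := by
      rw [abs_mul]; exact mul_le_mul hσ7 hdv (abs_nonneg _) (by norm_num)
    rw [abs_le] at *
    constructor <;> linarith [h1.1, h1.2, hdu.1, hdu.2]
  · obtain ⟨h6, hP⟩ := hσ ha
    have ha0 := abs_nonneg a
    have hM0 : 0 ≤ M := ha0.trans haM
    have hem : 0 ≤ e * |a| := mul_nonneg he ha0
    constructor
    · have h1 : |(σ + v - s) * dv| ≤ 6 * e * |a| + 7 * ε := by
        rw [abs_mul]
        have k1 := mul_le_mul_of_nonneg_left hdv (abs_nonneg (σ + v - s))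
        have k2 := mul_le_mul_of_nonneg_right h6 ha0
        have k3 := mul_le_mul_of_nonneg_right hσ7 hε
        linarith
      rw [abs_le] at *
      constructor <;> linarith [h1.1, h1.2, hdu.1, hdu.2]
    · have haa : a ^ 2 ≤ M * |a| := by
        rw [← sq_abs, sq]; exact mul_le_mul_of_nonneg_right haM ha0
      have hMa : 0 ≤ M * |a| := mul_nonneg hM0 ha0
      have k1 : |a| * |P| ≤ 20 * (e * M) * |a| := by
        rw [mul_comm]; exact mul_le_mul_of_nonneg_right hP ha0
      have k2 : a ^ 2 * |v| ≤ 4 * (e * M) * |a| :=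
        (mul_le_mul haa hv (abs_nonneg _) hMa).trans_eq (by ring)
      have k3 : |a| ^ 3 ≤ (e * M) * |a| := by
        have : |a| ^ 3 = a ^ 2 * |a| := by rw [← sq_abs]; ring
        rw [this]
        exact (mul_le_mul haa (haM.trans hMe) ha0 hMa).trans_eq (by ring)
      have k4 : |a ^ 2 * (σ + v - s)| ≤ 6 * (e * M) * |a| := by
        rw [abs_mul, abs_of_nonneg (sq_nonneg a)]
        exact (mul_le_mul haa h6 (abs_nonneg _) hMa).trans_eq (by ring)
      have : 0 ≤ e * M * |a| := by positivity
      have e1 : r - s * a ^ 2 / 4 = (r - a ^ 2 * (σ + v) / 4) + a ^ 2 * (σ + v - s) / 4 := by ring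
      rw [e1]
      rw [abs_le] at hr k4 ⊢
      constructor <;> linarith [hr.1, hr.2, k4.1, k4.2]

theorem isSmoothPeriodic_charSpeed {c₁ c₂ sg e : ℝ} {p s : ℝ × ℝ → ℝ} (hp : IsSmoothPeriodic p)
    (hs : IsSmoothPeriodic s) (he : e ≤ 1 / 100) (hu : ∀ z, |c₁ + partialX p z| ≤ e) :
    IsSmoothPeriodic fun z => charSpeed sg (c₁ + partialX p z) (c₂ + partialX s z) where
  smooth := by
    have h1 := hp.smooth.partialX
    have h2 := hs.smooth.partialX
    have h3 : ContDiff ℝ ∞ fun z => discriminant (c₁ + partialX p z) (c₂ + partialX s z) := by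
      unfold discriminant
      fun_prop
    have h4 := h3.sqrt fun z => (discriminant_pos (v := c₂ + partialX s z) he (hu z)).ne'
    unfold charSpeed
    fun_prop
  periodic t x := by simp only [hp.partialX.periodic, hs.partialX.periodic]

/-- Adding the first `J` of finitely many plane waves of amplitudes `a j` and speeds `σ j`,
one after the other. -/
theorem exists_partial_family (c₁ c₂ : ℝ) {ρ : ℝ} {p s : ℝ × ℝ → ℝ} (hp : Admissible ρ p)
    (hs : Admissible ρ s) {sg e M ε : ℝ} (hsg : sg = 1 ∨ sg = -1) (he : 0 < e) (he1 : e ≤ 1 / 100)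
    (hMe : M ≤ e) (hv : ∀ z, |c₂ + partialX s z| ≤ e) {N : ℕ} {a : ℕ → ℝ × ℝ → ℝ} {σ : ℕ → ℝ}
    (ha : ∀ j, Admissible ρ (a j)) (haM : ∀ j z, |a j z| ≤ M)
    (ha1 : ∀ z, ∑ j ∈ Finset.range N, |a j z| ≤ 2 * M)
    (ha2 : ∀ z, ∑ j ∈ Finset.range N, a j z ^ 2 ≤ M ^ 2)
    (hσ5 : ∀ j < N, |σ j| ≤ 5) (hσ : ∀ j z, a j z ≠ 0 → |σ j - sg| ≤ 2 * e ∧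
      |speedDefect (σ j) (c₁ + partialX p z) (c₂ + partialX s z)| ≤ e * M)
    (hε : 0 < ε) (hεN : 15 * (N * ε) ≤ e * M) (J : ℕ) (hJ : J ≤ N) :
    ∃ p' s' : ℝ × ℝ → ℝ, Admissible ρ p' ∧ Admissible ρ s' ∧ ∀ z,
      |p' z - p z| ≤ J * ε ∧
      |partialX s' z - partialX s z| ≤ ∑ j ∈ Finset.range J, |a j z| + J * ε ∧
      |(partialX p' z - partialX p z) - sg * (partialX s' z - partialX s z)| ≤
        (∑ j ∈ Finset.range J, a j z ^ 2) / 4 + 7 * e * ∑ j ∈ Finset.range J, |a j z|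
          + 15 * (J * ε) ∧
      |residualV c₁ c₂ p' s' z - residualV c₁ c₂ p s z + (∑ j ∈ Finset.range J, a j z ^ 2) / 4|
        ≤ J * ε ∧
      |residualU c₁ c₂ p' s' z - residualU c₁ c₂ p s z
          - sg * (∑ j ∈ Finset.range J, a j z ^ 2) / 4| ≤
        30 * (e * M) * ∑ j ∈ Finset.range J, |a j z| + J * ε := by
  induction J with
  | zero => exact ⟨p, s, hp, hs, fun z => by simp⟩
  | succ J ih =>
    obtain ⟨p', s', hp', hs', h⟩ := ih (by omega)
    obtain ⟨p'', s'', hp'', hs'', h'⟩ := exists_single_wave c₁ c₂ hp' hs' (ha J) (σ J) hε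
    refine ⟨p'', s'', hp'', hs'', fun z => ?_⟩
    obtain ⟨h1, h2, h3, h4, h5⟩ := h z
    obtain ⟨k1, k2, k3, k4, k5⟩ := h' z
    have hM0 : 0 ≤ M := (abs_nonneg _).trans (haM J z)
    have hS1 : ∑ j ∈ Finset.range J, |a j z| ≤ 2 * M :=
      (Finset.sum_le_sum_of_subset_of_nonneg (Finset.range_mono (by omega))
        fun _ _ _ => abs_nonneg _).trans (ha1 z)
    have hS2 : ∑ j ∈ Finset.range J, a j z ^ 2 ≤ M ^ 2 :=
      (Finset.sum_le_sum_of_subset_of_nonneg (Finset.range_mono (by omega))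
        fun _ _ _ => sq_nonneg _).trans (ha2 z)
    have hJε : J * ε ≤ N * ε := by
      have : (J : ℝ) ≤ N := by exact_mod_cast (by omega : J ≤ N)
      exact mul_le_mul_of_nonneg_right this hε.le
    have heM : e * M ≤ M / 100 := by nlinarith
    have heM0 : 0 ≤ e * M := by positivity
    have hMM : M ^ 2 ≤ e * M := by nlinarith
    have hdv : |partialX s' z - partialX s z| ≤ 3 * M := by linarith
    have hdu : |(partialX p' z - partialX p z) - sg * (partialX s' z - partialX s z)| ≤
        16 * (e * M) := by
      have : 7 * e * ∑ j ∈ Finset.range J, |a j z| ≤ 7 * e * (2 * M) :=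
        mul_le_mul_of_nonneg_left hS1 (by linarith)
      linarith
    have hv' : |c₂ + partialX s' z| ≤ 4 * e := by
      have e1 : c₂ + partialX s' z = (c₂ + partialX s z) + (partialX s' z - partialX s z) := by ring
      rw [e1]
      exact (abs_add_le _ _).trans (by linarith [hv z])
    have hsg' := abs_le.1 hv'
    have h7 : |σ J + (c₂ + partialX s' z) - sg| ≤ 7 := by
      have hJ5 := abs_le.1 (hσ5 J (by omega))
      rw [abs_le]
      rcases hsg with rfl | rfl <;> constructor <;> linarith [hsg'.1, hsg'.2, hJ5.1, hJ5.2]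
    have hP : a J z ≠ 0 → |σ J + (c₂ + partialX s' z) - sg| ≤ 6 * e ∧
        |speedDefect (σ J) (c₁ + partialX p' z) (c₂ + partialX s' z)| ≤ 20 * (e * M) := by
      intro hne
      obtain ⟨q1, q2⟩ := hσ J z hne
      constructor
      · have q3 := abs_le.1 q1
        rw [abs_le]
        constructor <;> linarith [hsg'.1, hsg'.2, q3.1, q3.2]
      · have e1 : c₁ + partialX p' z =
          (c₁ + partialX p z) + (partialX p' z - partialX p z) := by ring
        have e2 : c₂ + partialX s' z =
          (c₂ + partialX s z) + (partialX s' z - partialX s z) := by ring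
        rw [e1]
        rw [e2] at hv' ⊢
        exact abs_speedDefect_add_le he.le hM0 q1 q2 hdu hdv (hv z) hv'
    obtain ⟨r1, r2⟩ := wave_step_algebra he.le hMe (haM J z) h7 hP hv' hε.le k2 k3 k5
    simp only [Finset.sum_range_succ]
    push_cast
    refine ⟨?_, ?_, ?_, ?_, ?_⟩
    · rw [abs_le] at *
      constructor <;> linarith [h1.1, h1.2, k1.1, k1.2]
    · have := abs_add_le (partialX s'' z - partialX s' z) (partialX s' z - partialX s z)
      rw [sub_add_sub_cancel] at this
      linarith
    · rw [abs_le] at h3 r1 ⊢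
      constructor <;> linarith [h3.1, h3.2, r1.1, r1.2]
    · rw [abs_le] at h4 k4 ⊢
      constructor <;> linarith [h4.1, h4.2, k4.1, k4.2]
    · rw [abs_le] at h5 r2 ⊢
      constructor <;> linarith [h5.1, h5.2, r2.1, r2.2]

/-- Waves of one characteristic family with total amplitude `A` change the residual by
`(sg, -1) A² / 4` up to a small error. -/
theorem exists_wave_family (c₁ c₂ : ℝ) {ρ : ℝ} {p s A : ℝ × ℝ → ℝ} (hp : Admissible ρ p)
    (hs : Admissible ρ s) (hA : Admissible ρ A) {sg e M η : ℝ} (hsg : sg = 1 ∨ sg = -1)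
    (he : 0 < e) (he1 : e ≤ 1 / 100) (hM : 0 < M) (hMe : M ≤ e) (hAM : ∀ z, |A z| ≤ M)
    (hu : ∀ z, |c₁ + partialX p z| ≤ e) (hv : ∀ z, |c₂ + partialX s z| ≤ e) (hη : 0 < η) :
    ∃ p' s' : ℝ × ℝ → ℝ, Admissible ρ p' ∧ Admissible ρ s' ∧ ∀ z,
      |p' z - p z| ≤ η ∧
      |partialX p' z - partialX p z| ≤ 4 * M ∧
      |partialX s' z - partialX s z| ≤ 3 * M ∧
      |residualU c₁ c₂ p' s' z - residualU c₁ c₂ p s z - sg * A z ^ 2 / 4| ≤ 60 * e * M ^ 2 + η ∧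
      |residualV c₁ c₂ p' s' z - residualV c₁ c₂ p s z + A z ^ 2 / 4| ≤ η := by
  have heM : 0 < e * M := by positivity
  -- Mesh of the speeds: the defect is at most `4h = e M` when `σ` is within `h` of the
  -- characteristic speed.
  set h : ℝ := e * M / 4 with hh
  have hh0 : 0 < h := by positivity
  have hhe : h ≤ e := by rw [hh]; nlinarith
  set N : ℕ := ⌈5 / h⌉₊ with hN
  have hN1 : 5 / h ≤ N := Nat.le_ceil _
  have hN2 : (N : ℝ) < 5 / h + 1 := Nat.ceil_lt_add_one (by positivity)
  have hNpos : (0 : ℝ) < N := lt_of_lt_of_le (by positivity) hN1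
  -- Error allowed per wave, so that all `N` waves together cost at most `η` and at most `e M / 15`.
  set ε : ℝ := min (η / N) (e * M / (15 * N)) with hε
  have hε0 : 0 < ε := lt_min (by positivity) (by positivity)
  have hNη : N * ε ≤ η := by
    have : ε ≤ η / N := min_le_left _ _
    rw [le_div_iff₀ hNpos] at this
    linarith
  have hNe : 15 * (N * ε) ≤ e * M := by
    have : ε ≤ e * M / (15 * N) := min_le_right _ _
    rw [le_div_iff₀ (by positivity)] at this
    linarith
  set Λ : ℝ × ℝ → ℝ := fun z => charSpeed sg (c₁ + partialX p z) (c₂ + partialX s z) with hΛ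
  have hΛs : IsSmoothPeriodic Λ := isSmoothPeriodic_charSpeed hp.toIsSmoothPeriodic hs.toIsSmoothPeriodic he1 hu
  have hΛe : ∀ z, |Λ z - sg| ≤ e := fun z => abs_charSpeed_sub_le hsg he1 (hu z) (hv z)
  have hχ (j : ℕ) : IsSmoothPeriodic fun z => quadPartition j ((Λ z + 3) / h) :=
    ⟨(contDiff_quadPartition j).comp ((hΛs.smooth.add contDiff_const).div_const h), fun t x => by
      rw [hΛs.periodic]⟩
  -- The shift by `3` makes the argument positive for both signs: `Λ + 3` is close to `2` or `4`,
  -- between `h` and `5`.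
  have hy : ∀ z, 1 ≤ (Λ z + 3) / h ∧ (Λ z + 3) / h ≤ N := by
    intro z
    have h1 := abs_le.1 (hΛe z)
    constructor
    · rw [le_div_iff₀ hh0]
      rcases hsg with rfl | rfl <;> linarith [h1.1]
    · refine le_trans ?_ hN1
      apply div_le_div_of_nonneg_right _ hh0.le
      rcases hsg with rfl | rfl <;> linarith [h1.2]
  have hsum : ∀ z, ∑ j ∈ Finset.range N, (A z * quadPartition j ((Λ z + 3) / h)) ^ 2
      = A z ^ 2 := by
    intro z
    simp only [mul_pow]
    rw [← Finset.mul_sum, sum_quadPartition_sq (hy z).1 (hy z).2, mul_one]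
  -- The speed `h (j + 1) - 3` corresponds to the midpoint of the support interval `(j, j + 2)`,
  -- hence lies within `h` of `Λ` wherever the `j`-th wave lives.
  obtain ⟨p', s', hp', hs', H⟩ := exists_partial_family c₁ c₂ hp hs (sg := sg) (e := e) (M := M)
    (ε := ε) (N := N) (a := fun j z => A z * quadPartition j ((Λ z + 3) / h))
    (σ := fun j => h * (j + 1) - 3) hsg he he1 hMe hv (fun j => hA.mul_right (hχ j))
    (fun j z => by
      rw [abs_mul]
      exact (mul_le_of_le_one_right (abs_nonneg _) (abs_quadPartition_le _ _)).trans (hAM z))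
    (fun z => by
      simp only [abs_mul]
      rw [← Finset.mul_sum, mul_comm]
      exact mul_le_mul (sum_abs_quadPartition_le _ _) (hAM z) (abs_nonneg _) (by norm_num))
    (fun z => by
      rw [hsum z, ← sq_abs]
      exact pow_le_pow_left₀ (abs_nonneg _) (hAM z) 2)
    (fun j hj => by
      have hj' : (j : ℝ) + 1 ≤ N := by exact_mod_cast hj
      have h1 : h * (j + 1) ≤ h * N := mul_le_mul_of_nonneg_left hj' hh0.le
      have h2 : h * N ≤ h * (5 / h + 1) := mul_le_mul_of_nonneg_left hN2.le hh0.le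
      have h3 : h * (5 / h + 1) = 5 + h := by field_simp
      have h4 : 0 ≤ h * ((j : ℝ) + 1) := by positivity
      rw [abs_le]
      constructor <;> linarith)
    (fun j z hne => by
      obtain ⟨y1, y2⟩ := quadPartition_support (right_ne_zero_of_mul hne)
      rw [lt_div_iff₀ hh0] at y1
      rw [div_lt_iff₀ hh0] at y2
      have h1 : |h * ((j : ℝ) + 1) - 3 - Λ z| ≤ h := by
        rw [abs_le]; constructor <;> linarith
      constructor
      · have h2 := abs_le.1 h1
        have h3 := abs_le.1 (hΛe z)
        rw [abs_le]; constructor <;> linarith [h2.1, h2.2, h3.1, h3.2]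
      · exact (abs_speedDefect_le hsg he1 hhe (hu z) (hv z) h1).trans_eq (by rw [hh]; ring))
    hε0 hNe N le_rfl
  refine ⟨p', s', hp', hs', fun z => ?_⟩
  obtain ⟨h1, h2, h3, h4, h5⟩ := H z
  rw [hsum z] at h3 h4 h5
  have hA1 : ∑ j ∈ Finset.range N, |A z * quadPartition j ((Λ z + 3) / h)| ≤ 2 * M := by
    simp only [abs_mul]
    rw [← Finset.mul_sum, mul_comm]
    exact mul_le_mul (sum_abs_quadPartition_le _ _) (hAM z) (abs_nonneg _) (by norm_num)
  set S := ∑ j ∈ Finset.range N, |A z * quadPartition j ((Λ z + 3) / h)|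
  have hA2 : A z ^ 2 ≤ M ^ 2 := by
    rw [← sq_abs]
    exact pow_le_pow_left₀ (abs_nonneg _) (hAM z) 2
  have heM2 : e * M ≤ M / 100 := by nlinarith
  have hMM : M ^ 2 ≤ e * M := by nlinarith
  have heS : e * S ≤ 2 * (e * M) := by nlinarith
  have heS2 : e * M * S ≤ e * M * (2 * M) := mul_le_mul_of_nonneg_left hA1 heM.le
  have hs3 : |partialX s' z - partialX s z| ≤ 3 * M := by linarith
  refine ⟨h1.trans hNη, ?_, hs3, ?_, h4.trans hNη⟩
  · have h6 : |partialX p' z - partialX p z - sg * (partialX s' z - partialX s z)| ≤ M := by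
      linarith
    have h7 : |sg * (partialX s' z - partialX s z)| ≤ 3 * M := by
      rw [abs_mul]
      rcases hsg with rfl | rfl <;> simpa using hs3
    have := abs_add_le (partialX p' z - partialX p z - sg * (partialX s' z - partialX s z))
      (sg * (partialX s' z - partialX s z))
    rw [sub_add_cancel] at this
    linarith
  · linarith

/-! ### One stage of convex integration -/

theorem Admissible.residualU {c₁ c₂ ρ : ℝ} {p s : ℝ × ℝ → ℝ} (hp : Admissible ρ p)
    (hs : Admissible ρ s) : Admissible ρ (residualU c₁ c₂ p s) where
  smooth := by
    have h1 := hp.smooth.partialX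
    have h2 := hs.smooth.partialX
    have h3 := hp.smooth.partialT
    unfold _root_.residualU
    fun_prop
  periodic t x := by
    simp only [_root_.residualU, hp.toIsSmoothPeriodic.partialX.periodic,
      hs.toIsSmoothPeriodic.partialX.periodic, hp.toIsSmoothPeriodic.partialT.periodic]
  vanish z hz := by
    simp only [_root_.residualU, hp.partialX.vanish z hz, hs.partialX.vanish z hz,
      hp.partialT.vanish z hz]
    ring

theorem Admissible.residualV {c₁ c₂ ρ : ℝ} {p s : ℝ × ℝ → ℝ} (hp : Admissible ρ p)
    (hs : Admissible ρ s) : Admissible ρ (residualV c₁ c₂ p s) where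
  smooth := by
    have h1 := hp.smooth.partialX
    have h2 := hs.smooth.partialX
    have h3 := hs.smooth.partialT
    unfold _root_.residualV
    fun_prop
  periodic t x := by
    simp only [_root_.residualV, hp.toIsSmoothPeriodic.partialX.periodic,
      hs.toIsSmoothPeriodic.partialX.periodic, hs.toIsSmoothPeriodic.partialT.periodic]
  vanish z hz := by
    simp only [_root_.residualV, hp.partialX.vanish z hz, hs.partialX.vanish z hz,
      hs.partialT.vanish z hz]
    ring

/-- A subsolution: potentials `p, s` supported in `|t - 3| ≤ ρ` which solve the integrated system
up to a function `κ` of time alone and an error of size `δ`. -/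
structure IsSubsolution (c₁ c₂ ρ δ : ℝ) (p s : ℝ × ℝ → ℝ) (κ : ℝ → ℝ) : Prop where
  left : Admissible ρ p
  right : Admissible ρ s
  shift_smooth : ContDiff ℝ ∞ κ
  shift_vanish : ∀ t, ρ < |t - 3| → κ t = 0
  error_left : ∀ z, |residualU c₁ c₂ p s z| ≤ δ
  error_right : ∀ z, |residualV c₁ c₂ p s z + κ z.1| ≤ δ

/-- A smooth time cut-off, equal to `1` for `|t - 3| ≤ ρ` and to `0` for `|t - 3| ≥ ρ'`. -/
theorem exists_time_cutoff {ρ ρ' : ℝ} (hρ : 0 < ρ) (h : ρ < ρ') : ∃ χ : ℝ → ℝ, ContDiff ℝ ∞ χ ∧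
    (∀ t, |t - 3| ≤ ρ → χ t = 1) ∧ (∀ t, ρ' < |t - 3| → χ t = 0) ∧ ∀ t, |χ t| ≤ 1 := by
  let b : ContDiffBump (3 : ℝ) := ⟨ρ, ρ', hρ, h⟩
  refine ⟨b, b.contDiff, fun t ht => b.one_of_mem_closedBall ?_, fun t ht => b.zero_of_le_dist ?_,
    fun t => ?_⟩
  · simpa [Real.dist_eq] using ht
  · simpa [Real.dist_eq] using ht.le
  · rw [abs_of_nonneg b.nonneg]
    exact b.le_one

/-- The amplitude of the waves of sign `sg` which cancel an error `(R₁, R₂)` of size `δ`. -/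
theorem exists_amplitude {ρ ρ' δ sg : ℝ} (hδ : 0 < δ) {χ : ℝ → ℝ} (hχ : ContDiff ℝ ∞ χ)
    (hsg : sg = 1 ∨ sg = -1)
    (hχ0 : ∀ t, ρ' < |t - 3| → χ t = 0) (hχ1 : ∀ t, |χ t| ≤ 1) {R₁ R₂ : ℝ × ℝ → ℝ}
    (h₁ : Admissible ρ R₁) (h₂ : Admissible ρ R₂) (hR₁ : ∀ z, |R₁ z| ≤ δ) (hR₂ : ∀ z, |R₂ z| ≤ δ) :
    ∃ A : ℝ × ℝ → ℝ, Admissible ρ' A ∧ (∀ z, |A z| ≤ 4 * √δ) ∧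
      ∀ z, A z ^ 2 = χ z.1 ^ 2 * (8 * δ + 2 * R₂ z - sg * (2 * R₁ z)) := by
  -- The offset `8δ` dominates the residual terms, which total at most `4δ`. The radicand thus stays
  -- positive, making the square root smooth, and is at most `16δ`, which gives the amplitude `4√δ`.
  have hb : ∀ z, 4 * δ ≤ 8 * δ + 2 * R₂ z - sg * (2 * R₁ z) ∧
      8 * δ + 2 * R₂ z - sg * (2 * R₁ z) ≤ 16 * δ := fun z => by
    have k1 := abs_le.1 (hR₁ z)
    have k2 := abs_le.1 (hR₂ z)
    rcases hsg with rfl | rfl <;> constructor <;> linarith [k1.1, k1.2, k2.1, k2.2]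
  refine ⟨fun z => χ z.1 * √(8 * δ + 2 * R₂ z - sg * (2 * R₁ z)), ⟨⟨?_, ?_⟩, ?_⟩, ?_, ?_⟩
  · have k1 := h₁.smooth
    have k2 := h₂.smooth
    have k3 : ContDiff ℝ ∞ fun z => 8 * δ + 2 * R₂ z - sg * (2 * R₁ z) := by fun_prop
    exact (hχ.comp contDiff_fst).mul (k3.sqrt fun z => by linarith [(hb z).1])
  · intro t x
    simp only [h₁.periodic, h₂.periodic]
  · intro z hz
    simp only [hχ0 z.1 hz, zero_mul]
  · intro z
    have h4 : √(8 * δ + 2 * R₂ z - sg * (2 * R₁ z)) ≤ 4 * √δ := by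
      have h16 : 4 * √δ = √(16 * δ) := by
        rw [Real.sqrt_mul (by norm_num), show (16 : ℝ) = 4 ^ 2 by norm_num,
          Real.sqrt_sq (by norm_num)]
      rw [h16]
      exact Real.sqrt_le_sqrt (hb z).2
    rw [abs_mul, abs_of_nonneg (Real.sqrt_nonneg _)]
    have := mul_le_mul (hχ1 z.1) h4 (Real.sqrt_nonneg _) zero_le_one
    linarith
  · intro z
    simp only [mul_pow]
    rw [Real.sq_sqrt (by linarith [(hb z).1])]

/-- One stage of convex integration: the error is divided by `4`. -/
theorem IsSubsolution.exists_next {c₁ c₂ ρ ρ' δ e η : ℝ} {p s : ℝ × ℝ → ℝ} {κ : ℝ → ℝ}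
    (h : IsSubsolution c₁ c₂ ρ δ p s κ) (hρ : 0 < ρ) (hρ' : ρ < ρ') (hδ : 0 < δ) (he : 0 < e)
    (he1 : e ≤ 1 / 100000) (hδe : 32 * √δ ≤ e) (hη : 0 < η)
    (hu : ∀ z, |c₁ + partialX p z| ≤ e / 2) (hv : ∀ z, |c₂ + partialX s z| ≤ e / 2) :
    ∃ (p' s' : ℝ × ℝ → ℝ) (κ' : ℝ → ℝ), IsSubsolution c₁ c₂ ρ' (δ / 4) p' s' κ' ∧ ∀ z,
      |p' z - p z| ≤ η ∧ |partialX p' z - partialX p z| ≤ 32 * √δ ∧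
      |partialX s' z - partialX s z| ≤ 32 * √δ := by
  obtain ⟨χ, hχ, hχ1, hχ0, hχb⟩ := exists_time_cutoff hρ hρ'
  set R₁ := residualU c₁ c₂ p s with hR₁
  set R₂ : ℝ × ℝ → ℝ := fun z => residualV c₁ c₂ p s z + κ z.1 with hR₂
  have A₁ : Admissible ρ R₁ := h.left.residualU h.right
  have A₂ : Admissible ρ R₂ := by
    refine (h.left.residualV h.right).add ⟨⟨?_, ?_⟩, ?_⟩
    · exact h.shift_smooth.comp contDiff_fst
    · intro t x; rfl
    · exact fun z hz => h.shift_vanish z.1 hz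
  obtain ⟨A, hA, hAM, hA2⟩ := exists_amplitude hδ hχ (Or.inl rfl) hχ0 hχb A₁ A₂ h.error_left
    h.error_right
  obtain ⟨B, hB, hBM, hB2⟩ := exists_amplitude hδ hχ (Or.inr rfl) hχ0 hχb A₁ A₂ h.error_left
    h.error_right
  have hsq : 0 < √δ := Real.sqrt_pos.2 hδ
  have hM : 0 < 4 * √δ := by linarith
  have hM2 : (4 * √δ) ^ 2 = 16 * δ := by rw [mul_pow, Real.sq_sqrt hδ.le]; norm_num
  set τ := min (η / 2) (δ / 100) with hτ
  have hτ0 : 0 < τ := lt_min (by linarith) (by linarith)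
  have hτη : τ ≤ η / 2 := min_le_left _ _
  have hτδ : τ ≤ δ / 100 := min_le_right _ _
  obtain ⟨p₁, s₁, hp₁, hs₁, H₁⟩ := exists_wave_family c₁ c₂ (h.left.mono hρ'.le)
    (h.right.mono hρ'.le) hA (Or.inl rfl) he (by linarith) hM (by linarith) hAM
    (fun z => (hu z).trans (by linarith)) (fun z => (hv z).trans (by linarith)) hτ0
  obtain ⟨p₂, s₂, hp₂, hs₂, H₂⟩ := exists_wave_family c₁ c₂ hp₁ hs₁ hB (Or.inr rfl) he
    (by linarith) hM (by linarith) hBM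
    (fun z => by
      have e1 : c₁ + partialX p₁ z = (c₁ + partialX p z) + (partialX p₁ z - partialX p z) := by ring
      rw [e1]
      exact (abs_add_le _ _).trans (by linarith [hu z, (H₁ z).2.1]))
    (fun z => by
      have e1 : c₂ + partialX s₁ z = (c₂ + partialX s z) + (partialX s₁ z - partialX s z) := by ring
      rw [e1]
      exact (abs_add_le _ _).trans (by linarith [hv z, (H₁ z).2.2.1])) hτ0
  -- The cut-off loses nothing: it equals `1` where the old error can be nonzero.
  have hcut1 : ∀ z, χ z.1 ^ 2 * R₁ z = R₁ z := by
    intro z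
    rcases le_or_gt |z.1 - 3| ρ with hz | hz
    · rw [hχ1 _ hz]; ring
    · rw [A₁.vanish z hz, mul_zero]
  have hcut2 : ∀ z, χ z.1 ^ 2 * R₂ z = R₂ z := by
    intro z
    rcases le_or_gt |z.1 - 3| ρ with hz | hz
    · rw [hχ1 _ hz]; ring
    · rw [A₂.vanish z hz, mul_zero]
  -- Here `(A² - B²)/4 = -R₁` cancels the first error and `(A² + B²)/4 = R₂ + 4δχ²` the second, up
  -- to a function of time that is moved into the shift.
  refine ⟨p₂, s₂, fun t => κ t + 4 * δ * χ t ^ 2, ⟨hp₂, hs₂, ?_, ?_, ?_, ?_⟩, fun z => ⟨?_, ?_, ?_⟩⟩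
  · have := h.shift_smooth
    fun_prop
  · intro t ht
    simp only [h.shift_vanish t (hρ'.trans ht), hχ0 t ht]
    ring
  · intro z
    have k1 := (H₁ z).2.2.2.1
    have k2 := (H₂ z).2.2.2.1
    rw [hA2 z, hM2] at k1
    rw [hB2 z, hM2] at k2
    have hc := hcut1 z
    -- This fixes the size of `e`: the family error `60 e M²` with `M² = 16δ` is `960 e δ`. Two
    -- families then cost at most `2(δ/100 + τ)`, well below `δ/4`.
    have hs : 60 * e * (16 * δ) ≤ δ / 100 := by nlinarith
    change |residualU c₁ c₂ p₁ s₁ z - R₁ z - _| ≤ _ at k1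
    rw [abs_le] at k1 k2 ⊢
    constructor <;> linarith [k1.1, k1.2, k2.1, k2.2]
  · intro z
    have k1 := (H₁ z).2.2.2.2
    have k2 := (H₂ z).2.2.2.2
    rw [hA2 z] at k1
    rw [hB2 z] at k2
    have hc := hcut2 z
    have e2 : residualV c₁ c₂ p s z = R₂ z - κ z.1 := by simp [hR₂]
    rw [e2] at k1
    change |residualV c₁ c₂ p₂ s₂ z + (κ z.1 + 4 * δ * χ z.1 ^ 2)| ≤ _
    rw [abs_le] at k1 k2 ⊢
    constructor <;> linarith [k1.1, k1.2, k2.1, k2.2]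
  · have := abs_sub_le (p₂ z) (p₁ z) (p z)
    linarith [(H₁ z).1, (H₂ z).1]
  · have := abs_sub_le (partialX p₂ z) (partialX p₁ z) (partialX p z)
    linarith [(H₁ z).2.1, (H₂ z).2.1]
  · have := abs_sub_le (partialX s₂ z) (partialX s₁ z) (partialX s z)
    linarith [(H₁ z).2.2.1, (H₂ z).2.2.1]

/-! ### Weak formulation for potential flows -/

theorem ContDiff.continuous_partialT {φ : ℝ × ℝ → ℝ} (hφ : ContDiff ℝ 1 φ) :
    Continuous (_root_.partialT φ) :=
  (hφ.continuous_fderiv one_ne_zero).clm_apply continuous_const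

theorem ContDiff.continuous_partialX {φ : ℝ × ℝ → ℝ} (hφ : ContDiff ℝ 1 φ) :
    Continuous (_root_.partialX φ) :=
  (hφ.continuous_fderiv one_ne_zero).clm_apply continuous_const

theorem partialT_partialX_comm {P : ℝ × ℝ → ℝ} (hP : ContDiff ℝ ∞ P) (z : ℝ × ℝ) :
    partialT (partialX P) z = partialX (partialT P) z := by
  have hd : DifferentiableAt ℝ (fderiv ℝ P) z :=
    (hP.fderiv_right (m := ∞) (by simp)).differentiable (by simp) z
  have hsymm : IsSymmSndFDerivAt ℝ P z :=
    (contDiff_infty.1 hP 2).contDiffAt.isSymmSndFDerivAt (by simp)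
  have h1 : ∀ v w : ℝ × ℝ, fderiv ℝ (fun y => fderiv ℝ P y v) z w = fderiv ℝ (fderiv ℝ P) z w v := by
    intro v w
    rw [fderiv_clm_apply hd (differentiableAt_const v)]
    simp
  change fderiv ℝ (fun y => fderiv ℝ P y (0, 1)) z (1, 0) =
    fderiv ℝ (fun y => fderiv ℝ P y (1, 0)) z (0, 1)
  rw [h1, h1]
  exact hsymm _ _

/-- The weak formulation of `∂ₜ X + ∂ₓ Y = 0` on `[0, T] × [0, 1]`, tested against `φ`. -/
noncomputable def weakForm (φ : ℝ × ℝ → ℝ) (T : ℝ) (X Y : ℝ × ℝ → ℝ) : ℝ :=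
  (∫ t in (0 : ℝ)..T, ∫ x in (0 : ℝ)..1,
    (partialT φ (t, x) * X (t, x) + partialX φ (t, x) * Y (t, x)))
    + ∫ x in (0 : ℝ)..1, φ (0, x) * X (0, x)

theorem continuous_integral_unitInterval {E : Type*} [NormedAddCommGroup E] [NormedSpace ℝ E]
    {G : ℝ × ℝ → E} (hG : Continuous G) : Continuous fun t => ∫ x in (0 : ℝ)..1, G (t, x) :=
  intervalIntegral.continuous_parametric_intervalIntegral_of_continuous' (by fun_prop) _ _

theorem weakForm_sub {φ X Y X' Y' : ℝ × ℝ → ℝ} {T : ℝ} (hφ : ContDiff ℝ 1 φ) (hX : Continuous X)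
    (hY : Continuous Y) (hX' : Continuous X') (hY' : Continuous Y') :
    weakForm φ T X Y - weakForm φ T X' Y' =
      weakForm φ T (fun z => X z - X' z) (fun z => Y z - Y' z) := by
  have h0 := hφ.continuous
  have h1 := hφ.continuous_partialT
  have h2 := hφ.continuous_partialX
  have e1 : (∫ t in (0 : ℝ)..T, ∫ x in (0 : ℝ)..1, (partialT φ (t, x) * (X (t, x) - X' (t, x)) +
      partialX φ (t, x) * (Y (t, x) - Y' (t, x)))) =
      (∫ t in (0 : ℝ)..T, ∫ x in (0 : ℝ)..1,
        (partialT φ (t, x) * X (t, x) + partialX φ (t, x) * Y (t, x))) -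
      ∫ t in (0 : ℝ)..T, ∫ x in (0 : ℝ)..1,
        (partialT φ (t, x) * X' (t, x) + partialX φ (t, x) * Y' (t, x)) := by
    rw [← intervalIntegral.integral_sub]
    · refine intervalIntegral.integral_congr fun t _ => ?_
      rw [← intervalIntegral.integral_sub]
      · refine intervalIntegral.integral_congr fun x _ => ?_
        ring
      · exact Continuous.intervalIntegrable (by fun_prop) _ _
      · exact Continuous.intervalIntegrable (by fun_prop) _ _
    · exact (continuous_integral_unitInterval (G := fun z => partialT φ z * X z + partialX φ z * Y z)
        (by fun_prop)).intervalIntegrable _ _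
    · exact (continuous_integral_unitInterval
        (G := fun z => partialT φ z * X' z + partialX φ z * Y' z)
        (by fun_prop)).intervalIntegrable _ _
  have e2 : (∫ x in (0 : ℝ)..1, φ (0, x) * (X (0, x) - X' (0, x))) =
      (∫ x in (0 : ℝ)..1, φ (0, x) * X (0, x)) - ∫ x in (0 : ℝ)..1, φ (0, x) * X' (0, x) := by
    rw [← intervalIntegral.integral_sub]
    · refine intervalIntegral.integral_congr fun x _ => ?_
      ring
    · exact Continuous.intervalIntegrable (by fun_prop) _ _
    · exact Continuous.intervalIntegrable (by fun_prop) _ _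
  simp only [weakForm]
  rw [e1, e2]
  ring

theorem abs_weakForm_le {φ X Y : ℝ × ℝ → ℝ} {T B ε : ℝ} (hT : 0 ≤ T) (hB : 0 ≤ B)
    (h0 : ∀ z ∈ Icc 0 T ×ˢ Icc (0 : ℝ) 1, |φ z| ≤ B)
    (h1 : ∀ z ∈ Icc 0 T ×ˢ Icc (0 : ℝ) 1, |partialT φ z| ≤ B)
    (h2 : ∀ z ∈ Icc 0 T ×ˢ Icc (0 : ℝ) 1, |partialX φ z| ≤ B)
    (hX : ∀ z, |X z| ≤ ε) (hY : ∀ z, |Y z| ≤ ε) :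
    |weakForm φ T X Y| ≤ (2 * T + 1) * B * ε := by
  have k0 : |∫ x in (0 : ℝ)..1, φ (0, x) * X (0, x)| ≤ B * ε * |1 - 0| := by
    rw [← Real.norm_eq_abs]
    refine intervalIntegral.norm_integral_le_of_norm_le_const fun x hx => ?_
    rw [uIoc_of_le zero_le_one] at hx
    rw [Real.norm_eq_abs, abs_mul]
    exact mul_le_mul (h0 _ ⟨⟨le_rfl, hT⟩, hx.1.le, hx.2⟩) (hX _) (abs_nonneg _) hB
  have k1 : |∫ t in (0 : ℝ)..T, ∫ x in (0 : ℝ)..1,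
      (partialT φ (t, x) * X (t, x) + partialX φ (t, x) * Y (t, x))| ≤ 2 * B * ε * |T - 0| := by
    rw [← Real.norm_eq_abs]
    refine intervalIntegral.norm_integral_le_of_norm_le_const fun t ht => ?_
    rw [uIoc_of_le hT] at ht
    have : ‖∫ x in (0 : ℝ)..1,
      (partialT φ (t, x) * X (t, x) + partialX φ (t, x) * Y (t, x))‖ ≤ 2 * B * ε * |1 - 0| := by
      refine intervalIntegral.norm_integral_le_of_norm_le_const fun x hx => ?_
      rw [uIoc_of_le zero_le_one] at hx
      have hz : (t, x) ∈ Icc 0 T ×ˢ Icc (0 : ℝ) 1 := ⟨⟨ht.1.le, ht.2⟩, hx.1.le, hx.2⟩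
      rw [Real.norm_eq_abs]
      refine (abs_add_le _ _).trans ?_
      rw [abs_mul, abs_mul]
      have := mul_le_mul (h1 _ hz) (hX (t, x)) (abs_nonneg _) hB
      have := mul_le_mul (h2 _ hz) (hY (t, x)) (abs_nonneg _) hB
      linarith
    simpa using this
  rw [sub_zero, abs_one, mul_one] at k0
  rw [sub_zero, abs_of_nonneg hT] at k1
  refine (abs_add_le _ _).trans ((add_le_add k1 k0).trans_eq (by ring))

/-- The field `(c + Pₓ, d - Pₜ + κ(t))` is divergence free because mixed derivatives commute. The
divergence theorem for `φ` times it leaves only boundary terms: those at `x = 0, 1` cancel by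
periodicity, that at `t = T` vanishes, and that at `t = 0` is the initial term. -/
theorem weakForm_eq_zero_of_potential {φ P : ℝ × ℝ → ℝ} {κ : ℝ → ℝ} {c d T : ℝ}
    (hφ : ContDiff ℝ 1 φ) (hφper : ∀ t x, φ (t, x + 1) = φ (t, x)) (hφT : ∀ x, φ (T, x) = 0)
    (hP : IsSmoothPeriodic P) (hκ : ContDiff ℝ ∞ κ) :
    weakForm φ T (fun z => c + partialX P z) (fun z => d - partialT P z + κ z.1) = 0 := by
  have hX : ContDiff ℝ ∞ fun z => c + partialX P z := contDiff_const.add hP.smooth.partialX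
  have hY : ContDiff ℝ ∞ fun z : ℝ × ℝ => d - partialT P z + κ z.1 :=
    (contDiff_const.sub hP.smooth.partialT).add (hκ.comp contDiff_fst)
  have hX1 : ContDiff ℝ 1 fun z => φ z * (c + partialX P z) := hφ.mul (hX.of_le (by simp))
  have hY1 : ContDiff ℝ 1 fun z => φ z * (d - partialT P z + κ z.1) := hφ.mul (hY.of_le (by simp))
  have hdiv : ∀ z, fderiv ℝ (fun z => c + partialX P z) z (1, 0) +
      fderiv ℝ (fun z : ℝ × ℝ => d - partialT P z + κ z.1) z (0, 1) = 0 := by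
    intro z
    have q1 : DifferentiableAt ℝ (partialX P) z := hP.smooth.partialX.differentiable (by simp) z
    have q2 : DifferentiableAt ℝ (partialT P) z := hP.smooth.partialT.differentiable (by simp) z
    have q3 : HasFDerivAt (fun z : ℝ × ℝ => κ z.1)
        ((ContinuousLinearMap.toSpanSingleton ℝ (deriv κ z.1)).comp
          (ContinuousLinearMap.fst ℝ ℝ ℝ)) z :=
      ((hκ.differentiable (by simp) z.1).hasDerivAt.hasFDerivAt).comp z hasFDerivAt_fst
    have q4 : HasFDerivAt (fun z : ℝ × ℝ => d - partialT P z + κ z.1) _ z :=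
      (q2.hasFDerivAt.const_sub d).add q3
    rw [q4.fderiv, fderiv_const_add]
    have := partialT_partialX_comm hP.smooth z
    simp only [partialT, partialX] at this ⊢
    simp [this]
  have key := integral2_divergence_prod_of_hasFDerivAt_off_countable
    (fun z => φ z * (c + partialX P z)) (fun z => φ z * (d - partialT P z + κ z.1))
    (fderiv ℝ fun z => φ z * (c + partialX P z))
    (fderiv ℝ fun z => φ z * (d - partialT P z + κ z.1)) 0 0 T 1 ∅ countable_empty
    hX1.continuous.continuousOn hY1.continuous.continuousOn
    (fun z _ => (hX1.differentiable one_ne_zero z).hasFDerivAt)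
    (fun z _ => (hY1.differentiable one_ne_zero z).hasFDerivAt)
    (by
      apply ContinuousOn.integrableOn_compact (isCompact_uIcc.prod isCompact_uIcc)
      exact (((hX1.continuous_fderiv one_ne_zero).clm_apply continuous_const).add
        ((hY1.continuous_fderiv one_ne_zero).clm_apply continuous_const)).continuousOn)
  have e1 : ∀ z, fderiv ℝ (fun z => φ z * (c + partialX P z)) z (1, 0) +
      fderiv ℝ (fun z => φ z * (d - partialT P z + κ z.1)) z (0, 1) =
      partialT φ z * (c + partialX P z) + partialX φ z * (d - partialT P z + κ z.1) := by
    intro z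
    rw [fderiv_fun_mul (hφ.differentiable one_ne_zero z) (hX.differentiable (by simp) z),
      fderiv_fun_mul (hφ.differentiable one_ne_zero z) (hY.differentiable (by simp) z)]
    have := hdiv z
    simp only [add_apply, smul_apply, smul_eq_mul,
      partialT, partialX] at this ⊢
    linear_combination φ z * this
  simp only [e1] at key
  have hper : ∀ t, φ (t, 1) * (d - partialT P (t, 1) + κ t) =
      φ (t, 0) * (d - partialT P (t, 0) + κ t) := by
    intro t
    have h1 := hφper t 0
    have h2 := hP.partialT.periodic t 0
    rw [zero_add] at h1 h2
    rw [h1, h2]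
  simp only [hper, hφT, zero_mul, sub_self, intervalIntegral.integral_zero, zero_add] at key
  rw [weakForm, key]
  simp

/-- Uniform limits of potential flows are weak solutions. -/
theorem weakForm_eq_zero_of_approx {φ X Y : ℝ × ℝ → ℝ} {T : ℝ} (hT : 0 ≤ T)
    (hφ : ContDiff ℝ 1 φ) (hφper : ∀ t x, φ (t, x + 1) = φ (t, x)) (hφT : ∀ x, φ (T, x) = 0)
    (hX : Continuous X) (hY : Continuous Y)
    (happrox : ∀ ε > 0, ∃ (P : ℝ × ℝ → ℝ) (κ : ℝ → ℝ) (c d : ℝ), IsSmoothPeriodic P ∧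
      ContDiff ℝ ∞ κ ∧ ∀ z, |X z - (c + partialX P z)| ≤ ε ∧
        |Y z - (d - partialT P z + κ z.1)| ≤ ε) : weakForm φ T X Y = 0 := by
  have hc : IsCompact (Icc 0 T ×ˢ Icc (0 : ℝ) 1) := isCompact_Icc.prod isCompact_Icc
  obtain ⟨B₀, h0⟩ := hc.exists_bound_of_continuousOn hφ.continuous.continuousOn
  obtain ⟨B₁, h1⟩ := hc.exists_bound_of_continuousOn hφ.continuous_partialT.continuousOn
  obtain ⟨B₂, h2⟩ := hc.exists_bound_of_continuousOn hφ.continuous_partialX.continuousOn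
  set B := max 1 (max B₀ (max B₁ B₂)) with hB
  have hB1 : 1 ≤ B := le_max_left _ _
  by_contra hne
  have hpos : 0 < |weakForm φ T X Y| := abs_pos.2 hne
  have hTB : 0 < (2 * T + 1) * B := by positivity
  -- The accuracy is chosen so that the resulting estimate bounds `|weakForm φ T X Y|` by half of
  -- itself.
  obtain ⟨P, κ, c, d, hP, hκ, happ⟩ := happrox (|weakForm φ T X Y| / (2 * ((2 * T + 1) * B)))
    (by positivity)
  have hP1 := hP.smooth.partialX.continuous
  have hP2 := hP.smooth.partialT.continuous
  have hκ1 := hκ.continuous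
  have hdiff := weakForm_sub (T := T) hφ hX hY (X' := fun z => c + partialX P z)
    (Y' := fun z => d - partialT P z + κ z.1) (by fun_prop) (by fun_prop)
  rw [weakForm_eq_zero_of_potential hφ hφper hφT hP hκ, sub_zero] at hdiff
  have hle := abs_weakForm_le (φ := φ) (B := B) hT (by linarith)
    (fun z hz => (h0 z hz).trans ((le_max_left _ _).trans (le_max_right _ _)))
    (fun z hz => (h1 z hz).trans ((le_max_left _ _).trans
      ((le_max_right _ _).trans (le_max_right _ _))))
    (fun z hz => (h2 z hz).trans ((le_max_right _ _).trans
      ((le_max_right _ _).trans (le_max_right _ _))))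
    (fun z => (happ z).1) (fun z => (happ z).2)
  rw [← hdiff] at hle
  have : (2 * T + 1) * B * (|weakForm φ T X Y| / (2 * ((2 * T + 1) * B))) =
      |weakForm φ T X Y| / 2 := by
    field_simp
  rw [this] at hle
  linarith

/-! ### Iteration and passage to the limit -/

theorem exists_uniform_limit {F : ℕ → ℝ × ℝ → ℝ} {C : ℝ}
    (hF : ∀ n z, |F (n + 1) z - F n z| ≤ C / 2 / 2 ^ n) :
    ∃ G : ℝ × ℝ → ℝ, ∀ n z, |F n z - G z| ≤ C / 2 ^ n := by
  have h : ∀ z, ∃ g, Filter.Tendsto (fun n => F n z) Filter.atTop (nhds g) := fun z =>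
    cauchySeq_tendsto_of_complete (cauchySeq_of_le_geometric_two (C := C) fun n => by
      rw [Real.dist_eq, abs_sub_comm]
      exact hF n z)
  choose G hG using h
  refine ⟨G, fun n z => ?_⟩
  have := dist_le_of_le_geometric_two_of_tendsto (f := fun n => F n z) (C := C) (fun n => by
    rw [Real.dist_eq, abs_sub_comm]
    exact hF n z) (hG z) n
  rwa [Real.dist_eq] at this

theorem exists_geometric_le {C ε : ℝ} (hε : 0 < ε) : ∃ n : ℕ, C / 2 ^ n ≤ ε := by
  obtain ⟨n, hn⟩ := pow_unbounded_of_one_lt (C / ε) (one_lt_two : (1 : ℝ) < 2)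
  refine ⟨n, ?_⟩
  rw [div_lt_iff₀ hε] at hn
  rw [div_le_iff₀ (by positivity)]
  linarith

theorem continuous_of_uniform_limit {F : ℕ → ℝ × ℝ → ℝ} {G : ℝ × ℝ → ℝ} {C : ℝ}
    (hF : ∀ n, Continuous (F n)) (h : ∀ n z, |F n z - G z| ≤ C / 2 ^ n) : Continuous G := by
  refine continuous_of_uniform_approx_of_continuous fun U hU => ?_
  obtain ⟨ε, hε, hεU⟩ := Metric.mem_uniformity_dist.1 hU
  obtain ⟨n, hn⟩ := exists_geometric_le (C := C) (half_pos hε)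
  refine ⟨F n, hF n, fun z => hεU ?_⟩
  rw [dist_comm, Real.dist_eq]
  linarith [h n z]

/-- The iteration of the convex integration stage. -/
theorem IsSubsolution.exists_seq {c₁ c₂ δ e η : ℝ} {p s : ℝ × ℝ → ℝ} {κ : ℝ → ℝ}
    (h : IsSubsolution c₁ c₂ 1 δ p s κ) (hδ : 0 < δ) (he : 0 < e)
    (he1 : e ≤ 1 / 100000) (hδe : 256 * √δ ≤ e) (hη : 0 < η)
    (hu : ∀ z, |c₁ + partialX p z| ≤ e / 4) (hv : ∀ z, |c₂ + partialX s z| ≤ e / 4) :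
    ∃ (P S : ℕ → ℝ × ℝ → ℝ) (K : ℕ → ℝ → ℝ), P 0 = p ∧ S 0 = s ∧
      (∀ n, IsSubsolution c₁ c₂ 2 (δ / 4 ^ n) (P n) (S n) (K n)) ∧
      (∀ n z, |P (n + 1) z - P n z| ≤ η / 2 / 2 ^ n) ∧
      (∀ n z, |partialX (P (n + 1)) z - partialX (P n) z| ≤ 64 * √δ / 2 / 2 ^ n) ∧
      ∀ n z, |partialX (S (n + 1)) z - partialX (S n) z| ≤ 64 * √δ / 2 / 2 ^ n := by
  let X := (ℝ × ℝ → ℝ) × (ℝ × ℝ → ℝ) × (ℝ → ℝ)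
  -- The time radius `2 - 2⁻ⁿ` grows strictly from `1` and stays below `2`, leaving room for a
  -- cut-off at each stage. The term `64√δ (1 - 2⁻ⁿ)` is the sum of the displacements `32√δ 2⁻ᵐ` for
  -- `m < n`.
  let Q : ℕ → X → Prop := fun n x => IsSubsolution c₁ c₂ (2 - (1 / 2) ^ n) (δ / 4 ^ n) x.1 x.2.1 x.2.2
    ∧ ∀ z, |c₁ + partialX x.1 z| ≤ e / 4 + 64 * √δ * (1 - (1 / 2) ^ n) ∧
      |c₂ + partialX x.2.1 z| ≤ e / 4 + 64 * √δ * (1 - (1 / 2) ^ n)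
  let R : ℕ → X → X → Prop := fun n x y => ∀ z, |y.1 z - x.1 z| ≤ η / 2 / 2 ^ n ∧
    |partialX y.1 z - partialX x.1 z| ≤ 64 * √δ / 2 / 2 ^ n ∧
    |partialX y.2.1 z - partialX x.2.1 z| ≤ 64 * √δ / 2 / 2 ^ n
  have hsq : 0 < √δ := Real.sqrt_pos.2 hδ
  have h0 : Q 0 (p, s, κ) := by
    refine ⟨?_, fun z => ⟨?_, ?_⟩⟩
    · norm_num
      exact h
    · simpa using hu z
    · simpa using hv z
  have hstep : ∀ n x, Q n x → ∃ y, Q (n + 1) y ∧ R n x y := by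
    rintro n ⟨p, s, κ⟩ ⟨hsub, hb⟩
    have hq0 : (0 : ℝ) < (1 / 2) ^ n := by positivity
    have hq1 : ((1 : ℝ) / 2) ^ n ≤ 1 := pow_le_one₀ (by norm_num) (by norm_num)
    have hqs : ((1 : ℝ) / 2) ^ (n + 1) = (1 / 2) ^ n / 2 := by rw [pow_succ]; ring
    have hsqn : √(δ / 4 ^ n) = √δ * (1 / 2) ^ n := by
      have : δ / 4 ^ n = δ * ((1 / 2) ^ n) ^ 2 := by
        rw [← pow_mul, mul_comm n 2, pow_mul]
        norm_num
        rw [div_eq_mul_inv, one_div, inv_pow]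
      rw [this, Real.sqrt_mul hδ.le, Real.sqrt_sq hq0.le]
    have h64 : 64 * √δ / 2 / 2 ^ n = 32 * (√δ * (1 / 2) ^ n) := by
      rw [one_div, inv_pow]; field_simp; norm_num
    have hle : √δ * (1 / 2) ^ n ≤ √δ := mul_le_of_le_one_right hsq.le hq1
    have hbound : e / 4 + 64 * √δ * (1 - (1 / 2) ^ n) ≤ e / 2 := by nlinarith
    obtain ⟨p', s', κ', hsub', hz⟩ := hsub.exists_next (ρ' := 2 - (1 / 2) ^ (n + 1)) (e := e)
      (η := η / 2 / 2 ^ n) (by linarith) (by rw [hqs]; linarith) (by positivity) he he1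
      (by rw [hsqn]; linarith) (by positivity) (fun z => (hb z).1.trans hbound)
      (fun z => (hb z).2.trans hbound)
    rw [hsqn] at hz
    refine ⟨(p', s', κ'), ⟨?_, fun z => ⟨?_, ?_⟩⟩, fun z => ⟨(hz z).1, ?_, ?_⟩⟩
    · have : δ / 4 ^ (n + 1) = δ / 4 ^ n / 4 := by rw [pow_succ, div_div]
      rw [this]
      exact hsub'
    · have := abs_add_le (c₁ + partialX p z) (partialX p' z - partialX p z)
      have e1 : c₁ + partialX p z + (partialX p' z - partialX p z) = c₁ + partialX p' z := by ring
      rw [e1] at this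
      rw [hqs]
      have := (hb z).1
      have := (hz z).2.1
      simp only at *
      linarith
    · have := abs_add_le (c₂ + partialX s z) (partialX s' z - partialX s z)
      have e1 : c₂ + partialX s z + (partialX s' z - partialX s z) = c₂ + partialX s' z := by ring
      rw [e1] at this
      rw [hqs]
      have := (hb z).2
      have := (hz z).2.2
      simp only at *
      linarith
    · rw [h64]; exact (hz z).2.1
    · rw [h64]; exact (hz z).2.2
  choose! next hnext using hstep
  let seq : ℕ → X := fun n => Nat.rec (p, s, κ) next n
  have hseq : ∀ n, Q n (seq n) := fun n => by
    induction n with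
    | zero => exact h0
    | succ n ih => exact (hnext n _ ih).1
  have hrel : ∀ n, R n (seq n) (seq (n + 1)) := fun n => (hnext n _ (hseq n)).2
  refine ⟨fun n => (seq n).1, fun n => (seq n).2.1, fun n => (seq n).2.2, rfl, rfl, fun n => ?_,
    fun n z => (hrel n z).1, fun n z => (hrel n z).2.1, fun n z => (hrel n z).2.2⟩
  have hn := (hseq n).1
  have hq0 : (0 : ℝ) < (1 / 2) ^ n := by positivity
  exact ⟨hn.left.mono (by linarith), hn.right.mono (by linarith), hn.shift_smooth,
    fun t ht => hn.shift_vanish t (by linarith), hn.error_left, hn.error_right⟩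

theorem nonpos_of_le_geometric {a C : ℝ} (h : ∀ n : ℕ, a ≤ C / 2 ^ n) : a ≤ 0 := by
  by_contra! ha
  obtain ⟨n, hn⟩ := exists_geometric_le (C := C) (half_pos ha)
  linarith [h n]

theorem hasDerivAt_partialX {P : ℝ × ℝ → ℝ} (hP : ContDiff ℝ ∞ P) (t x : ℝ) :
    HasDerivAt (fun y => P (t, y)) (partialX P (t, x)) x := by
  have h1 : HasFDerivAt P (fderiv ℝ P (t, x)) (t, x) :=
    (hP.differentiable (by simp) (t, x)).hasFDerivAt
  exact h1.comp_hasDerivAt x ((hasDerivAt_const x t).prodMk (hasDerivAt_id x))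

/-- The initial subsolution: a small smooth bump in the first component. -/
theorem exists_initial_subsolution {c₁ c₂ δ : ℝ} (hδ : 0 < δ) (hc₂ : |c₂| ≤ 1) :
    ∃ (p : ℝ × ℝ → ℝ) (η : ℝ), IsSubsolution c₁ c₂ 1 δ p (fun _ => 0) (fun _ => 0) ∧
      (∀ z, |partialX p z| ≤ δ) ∧ 0 < η ∧ p (3, 1 / 4) = η ∧ p (3, 3 / 4) = -η := by
  obtain ⟨χ, hχ, hχ1, hχ0, -⟩ := exists_time_cutoff (ρ := 1 / 2) (ρ' := 1) (by norm_num)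
    (by norm_num)
  set q : ℝ × ℝ → ℝ := fun z => χ z.1 * Real.sin (2 * Real.pi * z.2) with hq
  have hqa : Admissible 1 q := by
    refine ⟨⟨by fun_prop, fun t x => ?_⟩, fun z hz => ?_⟩
    · have : 2 * Real.pi * (x + 1) = 2 * Real.pi * x + 2 * Real.pi := by ring
      simp only [hq, this, Real.sin_add_two_pi]
    · simp only [hq, hχ0 z.1 hz, zero_mul]
  obtain ⟨B₁, h₁⟩ := hqa.partialX.exists_bound
  obtain ⟨B₂, h₂⟩ := hqa.partialT.exists_bound
  set B := 1 + |B₁| + |B₂| with hB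
  have hBpos : 0 < B := by positivity
  -- With `s = 0` the residuals are linear in `p`, so scaling the bump makes them as small as
  -- desired.
  set η := δ / (2 * B) with hη
  have hη0 : 0 < η := by positivity
  have hηB : η * B = δ / 2 := by rw [hη]; field_simp
  have hx : ∀ z, |η * partialX q z| ≤ δ / 2 := fun z => by
    rw [abs_mul, abs_of_pos hη0, ← hηB]
    refine mul_le_mul_of_nonneg_left ((h₁ z).trans ((le_abs_self _).trans ?_)) hη0.le
    rw [hB]; linarith [abs_nonneg B₂]
  have ht : ∀ z, |η * partialT q z| ≤ δ / 2 := fun z => by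
    rw [abs_mul, abs_of_pos hη0, ← hηB]
    refine mul_le_mul_of_nonneg_left ((h₂ z).trans ((le_abs_self _).trans ?_)) hη0.le
    rw [hB]; linarith [abs_nonneg B₁]
  have ex : ∀ z, partialX (fun z => q z * η) z = η * partialX q z := fun z => by
    simp only [partialX]
    rw [fderiv_mul_const (hqa.smooth.differentiable (by simp) z)]
    simp
  have et : ∀ z, partialT (fun z => q z * η) z = η * partialT q z := fun z => by
    simp only [partialT]
    rw [fderiv_mul_const (hqa.smooth.differentiable (by simp) z)]
    simp
  have zx : ∀ z, partialX (fun _ => 0) z = 0 := fun z => by simp [partialX]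
  have zt : ∀ z, partialT (fun _ => 0) z = 0 := fun z => by simp [partialT]
  have hχ3 : χ 3 = 1 := hχ1 3 (by norm_num)
  refine ⟨fun z => q z * η, η, ⟨hqa.mul_right (.const η), ⟨.const 0, fun _ _ => rfl⟩,
    contDiff_const, fun _ _ => rfl, fun z => ?_, fun z => ?_⟩, fun z => ?_, hη0, ?_, ?_⟩
  · simp only [residualU, ex, et, zx]
    have e1 : η * partialT q z + ((c₁ + η * partialX q z) * (c₂ + 0) / 2 + (c₂ + 0)) -
      (c₁ * c₂ / 2 + c₂) = η * partialT q z + η * partialX q z * c₂ / 2 := by ring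
    have h3 : |η * partialX q z * c₂| ≤ δ / 2 := by
      rw [abs_mul]
      exact (mul_le_of_le_one_right (abs_nonneg _) hc₂).trans (hx z)
    have h4 := ht z
    rw [e1]
    rw [abs_le] at *
    constructor <;> linarith [h3.1, h3.2, h4.1, h4.2]
  · simp only [residualV, ex, zx, zt]
    have e1 : 0 + (c₁ + η * partialX q z - (c₂ + 0) ^ 2 / 2) - (c₁ - c₂ ^ 2 / 2) + 0 =
      η * partialX q z := by ring
    rw [e1]
    linarith [hx z]
  · rw [ex]
    linarith [hx z]
  · have : 2 * Real.pi * (1 / 4) = Real.pi / 2 := by ring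
    simp only [hq, hχ3, this]
    simp
  · have : 2 * Real.pi * (3 / 4) = Real.pi / 2 + Real.pi := by ring
    simp only [hq, hχ3, this, Real.sin_add_pi]
    simp

/-- `(X, Y)` is a uniform limit of potential flows, in the sense needed for it to be a weak
solution of `∂ₜ X + ∂ₓ Y = 0`. -/
def IsPotentialLimit (X Y : ℝ × ℝ → ℝ) : Prop :=
  ∀ ε > 0, ∃ (P : ℝ × ℝ → ℝ) (κ : ℝ → ℝ) (c d : ℝ), IsSmoothPeriodic P ∧
    ContDiff ℝ ∞ κ ∧ ∀ z, |X z - (c + partialX P z)| ≤ ε ∧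
      |Y z - (d - partialT P z + κ z.1)| ≤ ε

theorem flux_difference_le {x y x' y' r : ℝ} (hx : |x| ≤ 1) (hy : |y| ≤ 1) (hy' : |y'| ≤ 1)
    (h1 : |x - x'| ≤ r) (h2 : |y - y'| ≤ r) :
    |(x * y / 2 + y) - (x' * y' / 2 + y')| ≤ 2 * r ∧
    |(x - y ^ 2 / 2) - (x' - y' ^ 2 / 2)| ≤ 2 * r := by
  have hr : 0 ≤ r := (abs_nonneg _).trans h1
  have k1 : |x * (y - y')| ≤ 1 * r := by
    rw [abs_mul]; exact mul_le_mul hx h2 (abs_nonneg _) zero_le_one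
  have k2 : |(x - x') * y'| ≤ r * 1 := by
    rw [abs_mul]; exact mul_le_mul h1 hy' (abs_nonneg _) hr
  have k3 : |(y - y') * (y + y')| ≤ r * 2 := by
    rw [abs_mul]
    exact mul_le_mul h2 ((abs_add_le _ _).trans (by linarith)) (abs_nonneg _) hr
  have e1 : (x * y / 2 + y) - (x' * y' / 2 + y') =
    (x * (y - y') + (x - x') * y') / 2 + (y - y') := by ring
  have e2 : (x - y ^ 2 / 2) - (x' - y' ^ 2 / 2) = (x - x') - (y - y') * (y + y') / 2 := by ring
  rw [e1, e2]
  rw [abs_le] at h1 h2 k1 k2 k3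
  constructor <;> rw [abs_le] <;> constructor <;>
    linarith [h1.1, h1.2, h2.1, h2.2, k1.1, k1.2, k2.1, k2.2, k3.1, k3.2]

/-- A nonconstant continuous flow near a constant state, equal to it for `t < 1`. -/
theorem exists_nonconstant_flow {c₁ c₂ e r : ℝ} (he : 0 < e) (he1 : e ≤ 1 / 100000)
    (hc₁ : |c₁| ≤ e / 8) (hc₂ : |c₂| ≤ e / 8) (hr : 0 < r) :
    ∃ X Y : ℝ × ℝ → ℝ, Continuous X ∧ Continuous Y ∧
      (∀ t x, X (t, x + 1) = X (t, x)) ∧ (∀ t x, Y (t, x + 1) = Y (t, x)) ∧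
      (∀ z : ℝ × ℝ, 2 < |z.1 - 3| → X z = c₁ ∧ Y z = c₂) ∧
      (∀ z, |X z - c₁| ≤ r ∧ |Y z - c₂| ≤ r) ∧ (∃ x, X (3, x) ≠ c₁) ∧
      IsPotentialLimit X (fun z => X z * Y z / 2 + Y z) ∧
      IsPotentialLimit Y (fun z => X z - Y z ^ 2 / 2) := by
  -- With `√δ = τ`, the bound `256τ ≤ e` starts the iteration, and the total displacement `64τ + δ ≤
  -- 65τ` stays below `r`.
  set τ := min (e / 256) (r / 65) with hτ
  have hτ0 : 0 < τ := lt_min (by linarith) (by linarith)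
  have hτe : τ ≤ e / 256 := min_le_left _ _
  have hτr : τ ≤ r / 65 := min_le_right _ _
  set δ := τ ^ 2 with hδ
  have hδ0 : 0 < δ := by positivity
  have hsq : √δ = τ := Real.sqrt_sq hτ0.le
  have hδτ : δ ≤ τ := by rw [hδ]; nlinarith
  obtain ⟨p, η, hsub, hpx, hη, hp1, hp3⟩ :=
    exists_initial_subsolution (c₁ := c₁) (c₂ := c₂) hδ0 (by linarith)
  have zx : ∀ z, partialX (fun _ => 0) z = 0 := fun z => by simp [partialX]
  obtain ⟨P, S, K, hP0, hS0, hPS, hP, hPx, hSx⟩ := hsub.exists_seq (η := η / 4) (e := e) hδ0 he he1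
    (by rw [hsq]; linarith) (by linarith)
    (fun z => (abs_add_le _ _).trans (by linarith [hpx z]))
    (fun z => by rw [zx, add_zero]; linarith)
  obtain ⟨G, hG⟩ := exists_uniform_limit hP
  obtain ⟨X, hX⟩ := exists_uniform_limit (F := fun n => partialX (P n)) hPx
  obtain ⟨Y, hY⟩ := exists_uniform_limit (F := fun n => partialX (S n)) hSx
  rw [hsq] at hX hY
  set C := 64 * τ with hC
  have hXc : Continuous X := continuous_of_uniform_limit
    (fun n => (hPS n).left.smooth.partialX.continuous) hX
  have hYc : Continuous Y := continuous_of_uniform_limit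
    (fun n => (hPS n).right.smooth.partialX.continuous) hY
  have hper : ∀ {F : ℕ → ℝ × ℝ → ℝ} {H : ℝ × ℝ → ℝ}, (∀ n, Admissible 2 (F n)) →
      (∀ n z, |partialX (F n) z - H z| ≤ C / 2 ^ n) →
      (∀ t x, c₁ + H (t, x + 1) = c₁ + H (t, x)) ∧ (∀ t x, c₂ + H (t, x + 1) = c₂ + H (t, x)) ∧
      ∀ z : ℝ × ℝ, 2 < |z.1 - 3| → H z = 0 := by
    intro F H hF hH
    have h1 : ∀ t x, H (t, x + 1) = H (t, x) := fun t x => by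
      have : |H (t, x + 1) - H (t, x)| ≤ 0 := nonpos_of_le_geometric (C := 2 * C) fun n => by
        have k1 := hH n (t, x + 1)
        have k2 := hH n (t, x)
        rw [(hF n).partialX.periodic, abs_sub_comm] at k1
        have := abs_sub_le (H (t, x + 1)) (partialX (F n) (t, x)) (H (t, x))
        rw [mul_div_assoc]
        linarith
      exact sub_eq_zero.1 (abs_nonpos_iff.1 this)
    refine ⟨fun t x => by rw [h1], fun t x => by rw [h1], fun z hz => ?_⟩
    refine abs_nonpos_iff.1 (nonpos_of_le_geometric (C := C) fun n => ?_)
    have := hH n z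
    rwa [(hF n).partialX.vanish z hz, zero_sub, abs_neg] at this
  have hbX : ∀ z, |X z| ≤ 65 * τ := fun z => by
    have h := hX 0 z
    rw [hP0, pow_zero, div_one] at h
    have := abs_sub_le (X z) (partialX p z) 0
    rw [sub_zero, sub_zero, abs_sub_comm (X z)] at this
    linarith [hpx z]
  have hbY : ∀ z, |Y z| ≤ 65 * τ := fun z => by
    have h := hY 0 z
    rw [hS0, pow_zero, div_one, zx, zero_sub, abs_neg] at h
    linarith
  have hb1 : ∀ z, |c₁ + X z| ≤ 1 := fun z => (abs_add_le _ _).trans (by linarith [hbX z])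
  have hb2 : ∀ z, |c₂ + Y z| ≤ 1 := fun z => (abs_add_le _ _).trans (by linarith [hbY z])
  have hCn : ∀ n : ℕ, C / 2 ^ n ≤ C := fun n =>
    div_le_self (by positivity) (one_le_pow₀ one_le_two)
  have hb2' : ∀ n z, |c₂ + partialX (S n) z| ≤ 1 := fun n z => by
    have h1 := abs_add_le (c₂ + Y z) (partialX (S n) z - Y z)
    have e1 : c₂ + Y z + (partialX (S n) z - Y z) = c₂ + partialX (S n) z := by ring
    rw [e1] at h1
    linarith [abs_add_le c₂ (Y z), hbY z, hY n z, hCn n]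
  have hdX : ∀ n z, |(c₁ + X z) - (c₁ + partialX (P n) z)| ≤ C / 2 ^ n := fun n z => by
    rw [add_sub_add_left_eq_sub, abs_sub_comm]
    exact hX n z
  have hdY : ∀ n z, |(c₂ + Y z) - (c₂ + partialX (S n) z)| ≤ C / 2 ^ n := fun n z => by
    rw [add_sub_add_left_eq_sub, abs_sub_comm]
    exact hY n z
  have hδn : ∀ n : ℕ, δ / 4 ^ n ≤ δ / 2 ^ n := fun n =>
    div_le_div_of_nonneg_left hδ0.le (by positivity)
      (pow_le_pow_left₀ (by norm_num) (by norm_num) n)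
  have hpick : ∀ ε > 0, ∃ n : ℕ, C / 2 ^ n ≤ ε ∧ 2 * (C / 2 ^ n) + δ / 4 ^ n ≤ ε := by
    intro ε hε
    obtain ⟨n, hn⟩ := exists_geometric_le (C := 2 * C + δ) hε
    refine ⟨n, le_trans ?_ hn, le_trans ?_ hn⟩
    · exact div_le_div_of_nonneg_right (by linarith) (by positivity)
    · have : (2 * C + δ) / 2 ^ n = 2 * (C / 2 ^ n) + δ / 2 ^ n := by ring
      rw [this]
      linarith [hδn n]
  obtain ⟨pX1, -, vX⟩ := hper (fun n => (hPS n).left) hX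
  obtain ⟨-, pY2, vY⟩ := hper (fun n => (hPS n).right) hY
  refine ⟨fun z => c₁ + X z, fun z => c₂ + Y z, by fun_prop, by fun_prop, pX1, pY2,
    fun z hz => ⟨by simp [vX z hz], by simp [vY z hz]⟩,
    fun z => ⟨?_, ?_⟩, ?_, ?_, ?_⟩
  · rw [add_sub_cancel_left]
    linarith [hbX z]
  · rw [add_sub_cancel_left]
    linarith [hbY z]
  -- If `X` vanished at time `3`, then `∂ₓ(P n)` would be at most `η` there for some `n`. But `P n`
  -- stays within `η/2` of `p`, so it drops by at least `η` between `1/4` and `3/4`, which forces a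
  -- slope of at most `-2η` somewhere.
  · by_contra! hcon
    obtain ⟨n, hn⟩ := exists_geometric_le (C := C) hη
    have hcl : ∀ z, |P n z - p z| ≤ η / 2 := fun z => by
      have h1 := hG n z
      have h2 := hG 0 z
      rw [hP0, pow_zero, div_one, abs_sub_comm] at h2
      have h3 : η / 4 / 2 ^ n ≤ η / 4 := div_le_self (by positivity) (one_le_pow₀ one_le_two)
      linarith [abs_sub_le (P n z) (G z) (p z)]
    obtain ⟨ξ, -, hξ⟩ := exists_hasDerivAt_eq_slope (fun y => P n (3, y))
      (fun y => partialX (P n) (3, y)) (a := 1 / 4) (b := 3 / 4) (by norm_num)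
      (by
        have := (hPS n).left.smooth.continuous
        fun_prop) fun x _ => hasDerivAt_partialX (hPS n).left.smooth 3 x
    have h1 := abs_le.1 (hcl (3, 1 / 4))
    have h2 := abs_le.1 (hcl (3, 3 / 4))
    rw [hp1] at h1
    rw [hp3] at h2
    have h3 := hX n (3, ξ)
    have h4 : X (3, ξ) = 0 := by linarith [hcon ξ]
    rw [h4, sub_zero, hξ, abs_le] at h3
    norm_num at h3
    linarith [h3.1, h1.1, h2.2]
  · intro ε hε
    obtain ⟨n, hn1, hn2⟩ := hpick ε hε
    refine ⟨P n, fun _ => 0, c₁, c₁ * c₂ / 2 + c₂, (hPS n).left.toIsSmoothPeriodic,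
      contDiff_const, fun z => ⟨(hdX n z).trans hn1, ?_⟩⟩
    have k1 := (flux_difference_le (hb1 z) (hb2 z) (hb2' n z) (hdX n z) (hdY n z)).1
    have k2 := (hPS n).error_left z
    rw [residualU] at k2
    rw [abs_le] at *
    constructor <;> linarith [k1.1, k1.2, k2.1, k2.2]
  · intro ε hε
    obtain ⟨n, hn1, hn2⟩ := hpick ε hε
    -- The sign is reversed because `K n` was added to the residual, whereas here it belongs to the
    -- flux.
    refine ⟨S n, fun t => -K n t, c₂, c₁ - c₂ ^ 2 / 2, (hPS n).right.toIsSmoothPeriodic,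
      (hPS n).shift_smooth.neg, fun z => ⟨(hdY n z).trans hn1, ?_⟩⟩
    have k1 := (flux_difference_le (hb1 z) (hb2 z) (hb2' n z) (hdX n z) (hdY n z)).2
    have k2 := (hPS n).error_right z
    rw [residualV] at k2
    rw [abs_le] at *
    constructor <;> linarith [k1.1, k1.2, k2.1, k2.2]

/-! ### Descent to the torus -/

theorem continuous_of_lift {u : ℝ → UnitAddCircle → State} {X Y : ℝ × ℝ → ℝ} (hX : Continuous X)
    (hY : Continuous Y) (hu : ∀ t (x : ℝ), u t x = !₂[X (t, x), Y (t, x)]) :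
    Continuous fun p : ℝ × UnitAddCircle => u p.1 p.2 := by
  have hq : IsOpenQuotientMap (Prod.map id ((↑) : ℝ → UnitAddCircle) : ℝ × ℝ → _) :=
    IsOpenQuotientMap.id.prodMap QuotientAddGroup.isOpenQuotientMap_mk
  rw [← hq.continuous_comp_iff]
  have : ((fun p : ℝ × UnitAddCircle => u p.1 p.2) ∘ Prod.map id ((↑) : ℝ → UnitAddCircle)) =
      fun z : ℝ × ℝ => !₂[X z, Y z] := by
    funext z
    exact hu z.1 z.2
  rw [this]
  refine (PiLp.continuous_toLp 2 _).comp (continuous_pi fun i => ?_)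
  fin_cases i
  · exact hX
  · exact hY

theorem IsTestFunction.deriv_eq {φ : ℝ → UnitAddCircle → ℝ} (hφ : IsTestFunction φ) (t x : ℝ) :
    deriv (fun s => φ s x) t = partialT (fun p : ℝ × ℝ => φ p.1 (p.2 : UnitAddCircle)) (t, x) := by
  have h1 := (hφ.contDiff.differentiable one_ne_zero (t, x)).hasFDerivAt
  exact (h1.comp_hasDerivAt t ((hasDerivAt_id t).prodMk (hasDerivAt_const t x))).deriv

theorem IsTestFunction.torusDeriv_eq {φ : ℝ → UnitAddCircle → ℝ} (hφ : IsTestFunction φ)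
    (t x : ℝ) : torusDeriv (φ t) x =
      partialX (fun p : ℝ × ℝ => φ p.1 (p.2 : UnitAddCircle)) (t, x) := by
  have h1 : HasFDerivAt (fun p : ℝ × ℝ => φ p.1 (p.2 : UnitAddCircle))
      (fderiv ℝ (fun p : ℝ × ℝ => φ p.1 (p.2 : UnitAddCircle)) (t, x)) (t, x + 0) := by
    rw [add_zero]
    exact (hφ.contDiff.differentiable one_ne_zero (t, x)).hasFDerivAt
  have h2 : HasDerivAt (fun h : ℝ => (t, x + h)) (0, 1) 0 :=
    (hasDerivAt_const 0 t).prodMk ((hasDerivAt_id 0).const_add x)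
  exact (h1.comp_hasDerivAt (0 : ℝ) h2).deriv

theorem IsTestFunction.exists_vanish {φ : ℝ → UnitAddCircle → ℝ} (hφ : IsTestFunction φ) :
    ∃ T : ℝ, 0 ≤ T ∧ ∀ t, T ≤ t → ∀ x, φ t x = 0 := by
  obtain ⟨b, hb⟩ := (hφ.compactSupport.isCompact.image continuous_fst).bddAbove
  refine ⟨max b 0 + 1, by positivity, fun t ht x => ?_⟩
  by_contra hne
  have := hb ⟨(t, x), subset_tsupport _ hne, rfl⟩
  simp only at this
  linarith [le_max_left b 0]

/-- A pair of periodic functions of `(t, x)` whose components are limits of potential flows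
descends to a weak solution on the torus. -/
theorem isWeakSolution_of_lift {u : ℝ → UnitAddCircle → State} {X Y : ℝ × ℝ → ℝ}
    (hX : Continuous X) (hY : Continuous Y)
    (hu : ∀ t (x : ℝ), u t x = !₂[X (t, x), Y (t, x)]) {C : ℝ} (hC : ∀ t x, ‖u t x‖ ≤ C)
    (h₁ : IsPotentialLimit X fun z => X z * Y z / 2 + Y z)
    (h₂ : IsPotentialLimit Y fun z => X z - Y z ^ 2 / 2) :
    IsWeakSolution exampleFlux u (u 0) := by
  have hcont := continuous_of_lift hX hY hu
  have hcont0 : Continuous (u 0) := hcont.comp (Continuous.prodMk_right 0)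
  refine ⟨⟨C, fun t _ x => hC t x⟩, hcont.aestronglyMeasurable, ⟨C, fun x => hC 0 x⟩,
    hcont0.aestronglyMeasurable, fun φ hφ => ?_⟩
  set ψ : ℝ × ℝ → ℝ := fun p => φ p.1 (p.2 : UnitAddCircle) with hψ
  obtain ⟨T, hT, hvan⟩ := hφ.exists_vanish
  have hψ1 : ContDiff ℝ 1 ψ := hφ.contDiff
  have hψper : ∀ t x, ψ (t, x + 1) = ψ (t, x) := fun t x => by
    simp only [hψ]
    congr 1
    exact AddCircle.coe_add_period 1 x
  have cψ := hψ1.continuous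
  have cT := hψ1.continuous_partialT
  have cX := hψ1.continuous_partialX
  set f₁ : ℝ × ℝ → ℝ := fun z => X z * Y z / 2 + Y z with hf₁
  set f₂ : ℝ × ℝ → ℝ := fun z => X z - Y z ^ 2 / 2 with hf₂
  have cf₁ : Continuous f₁ := by fun_prop
  have cf₂ : Continuous f₂ := by fun_prop
  set G : ℝ × ℝ → State := fun z => !₂[partialT ψ z * X z + partialX ψ z * f₁ z,
    partialT ψ z * Y z + partialX ψ z * f₂ z] with hG
  set G₀ : ℝ → State := fun x => !₂[ψ (0, x) * X (0, x), ψ (0, x) * Y (0, x)] with hG₀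
  have cG : Continuous G := by
    refine (PiLp.continuous_toLp 2 _).comp (continuous_pi fun i => ?_)
    fin_cases i
    · change Continuous fun z => partialT ψ z * X z + partialX ψ z * f₁ z
      fun_prop
    · change Continuous fun z => partialT ψ z * Y z + partialX ψ z * f₂ z
      fun_prop
  have cG₀ : Continuous G₀ := by
    refine (PiLp.continuous_toLp 2 _).comp (continuous_pi fun i => ?_)
    fin_cases i
    · change Continuous fun x => ψ (0, x) * X (0, x)
      fun_prop
    · change Continuous fun x => ψ (0, x) * Y (0, x)
      fun_prop
  have inner : ∀ t, (∫ x : UnitAddCircle,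
      (deriv (fun s => φ s x) t • u t x + torusDeriv (φ t) x • exampleFlux (u t x))) =
      ∫ x in (0 : ℝ)..1, G (t, x) := by
    intro t
    rw [← UnitAddCircle.intervalIntegral_preimage 0, zero_add]
    refine intervalIntegral.integral_congr fun x _ => ?_
    simp only [hφ.deriv_eq, hφ.torusDeriv_eq, hu, hG]
    ext i
    fin_cases i <;> simp [exampleFlux, hf₁, hf₂, hψ]
  have init : (∫ x : UnitAddCircle, φ 0 x • u 0 x) = ∫ x in (0 : ℝ)..1, G₀ x := by
    rw [← UnitAddCircle.intervalIntegral_preimage 0, zero_add]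
    refine intervalIntegral.integral_congr fun x _ => ?_
    simp only [hu, hG₀]
    ext i
    fin_cases i <;> simp [hψ]
  have hzero : ∀ t, T < t → ∫ x in (0 : ℝ)..1, G (t, x) = 0 := by
    intro t ht
    -- Beyond time `T` the test function vanishes on an open set, so its derivatives vanish too.
    have hf : ∀ x, fderiv ℝ ψ (t, x) = 0 := fun x => by
      have hev : ψ =ᶠ[nhds (t, x)] fun _ => (0 : ℝ) := by
        filter_upwards [(isOpen_lt continuous_const continuous_fst).mem_nhds ht] with w hw
        exact hvan w.1 (le_of_lt hw) w.2
      rw [hev.fderiv_eq]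
      simp
    have : ∀ x, G (t, x) = 0 := fun x => by
      ext i
      fin_cases i <;> simp [hG, partialT, partialX, hf]
    simp [this]
  have outer : (∫ t in Ioi (0 : ℝ), ∫ x in (0 : ℝ)..1, G (t, x)) =
      ∫ t in (0 : ℝ)..T, ∫ x in (0 : ℝ)..1, G (t, x) := by
    rw [intervalIntegral.integral_of_le hT]
    refine setIntegral_eq_of_subset_of_forall_sdiff_eq_zero measurableSet_Ioi
      (fun t ht => ht.1) fun t ht => hzero t ?_
    by_contra hle
    exact ht.2 ⟨ht.1, not_lt.1 hle⟩
  have comp : ∀ i : Fin 2, ((∫ t in (0 : ℝ)..T, ∫ x in (0 : ℝ)..1, G (t, x)) +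
      ∫ x in (0 : ℝ)..1, G₀ x) i = (∫ t in (0 : ℝ)..T, ∫ x in (0 : ℝ)..1, G (t, x) i) +
      ∫ x in (0 : ℝ)..1, G₀ x i := by
    intro i
    let L : State →L[ℝ] ℝ := EuclideanSpace.proj i
    change L ((∫ t in (0 : ℝ)..T, ∫ x in (0 : ℝ)..1, G (t, x)) + ∫ x in (0 : ℝ)..1, G₀ x) = _
    rw [map_add, ← L.intervalIntegral_comp_comm
      ((continuous_integral_unitInterval cG).intervalIntegrable _ _),
      ← L.intervalIntegral_comp_comm (cG₀.intervalIntegrable _ _)]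
    congr 1
    refine intervalIntegral.integral_congr fun t _ => ?_
    exact (L.intervalIntegral_comp_comm
      ((cG.comp (Continuous.prodMk_right t)).intervalIntegrable _ _)).symm
  simp only [inner]
  rw [init, outer]
  have hψT : ∀ x, ψ (T, x) = 0 := fun x => hvan T le_rfl x
  ext i
  rw [comp i]
  fin_cases i
  · exact weakForm_eq_zero_of_approx hT hψ1 hψper hψT hX cf₁ h₁
  · exact weakForm_eq_zero_of_approx hT hψ1 hψper hψT hY cf₂ h₂

/-! ### Strict hyperbolicity and genuine nonlinearity -/

/-- A square in state space on which the system is strictly hyperbolic and, although close to the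
line `v = 0` of linear degeneracy, genuinely nonlinear. -/
def hyperbolicSquare (e : ℝ) : Set State := {U | |U 0| < e ∧ 0 < U 1 ∧ U 1 < e}

theorem isOpen_hyperbolicSquare (e : ℝ) : IsOpen (hyperbolicSquare e) := by
  refine (isOpen_lt (f := fun U : State => |U 0|) (g := fun _ => e) (by fun_prop)
    continuous_const).inter
    ((isOpen_lt (f := fun _ : State => (0 : ℝ)) (g := fun U : State => U 1) continuous_const
      (by fun_prop)).inter
    (isOpen_lt (f := fun U : State => U 1) (g := fun _ => e) (by fun_prop) continuous_const))

theorem isConnected_hyperbolicSquare {e : ℝ} (he : 0 < e) : IsConnected (hyperbolicSquare e) := by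
  refine ⟨⟨!₂[0, e / 2], ?_⟩, Convex.isPreconnected ?_⟩
  · simp [hyperbolicSquare]
    exact he
  · intro U hU W hW a b ha hb hab
    obtain ⟨h1, h2, h3⟩ := hU
    obtain ⟨k1, k2, k3⟩ := hW
    rw [abs_lt] at h1 k1
    have key : ∀ x y : ℝ, 0 < x → 0 < y → 0 < a * x + b * y := fun x y hx hy => by
      rcases ha.eq_or_lt with rfl | ha
      · rw [show b = 1 by linarith]; linarith
      · have := mul_nonneg hb hy.le
        have := mul_pos ha hx
        linarith
    have e0 : b = 1 - a := by linarith
    refine ⟨?_, ?_, ?_⟩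
    · simp only [PiLp.add_apply, PiLp.smul_apply, smul_eq_mul]
      rw [abs_lt]
      have q1 := key _ _ (by linarith : 0 < e - U 0) (by linarith : 0 < e - W 0)
      have q2 := key _ _ (by linarith : 0 < e + U 0) (by linarith : 0 < e + W 0)
      rw [e0] at *
      constructor <;> linarith
    · simp only [PiLp.add_apply, PiLp.smul_apply, smul_eq_mul]
      exact key _ _ h2 k2
    · simp only [PiLp.add_apply, PiLp.smul_apply, smul_eq_mul]
      have q1 := key _ _ (by linarith : 0 < e - U 1) (by linarith : 0 < e - W 1)
      rw [e0] at *
      linarith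

theorem fderiv_exampleFlux (U W : State) : fderiv ℝ exampleFlux U W =
    !₂[(W 0 * U 1 + U 0 * W 1) / 2 + W 1, W 0 - U 1 * W 1] := by
  let L₀ : State →L[ℝ] ℝ := EuclideanSpace.proj 0
  let L₁ : State →L[ℝ] ℝ := EuclideanSpace.proj 1
  have d₀ : HasFDerivAt (fun U : State => U 0) L₀ U := L₀.hasFDerivAt
  have d₁ : HasFDerivAt (fun U : State => U 1) L₁ U := L₁.hasFDerivAt
  have hdiff : DifferentiableAt ℝ exampleFlux U := by
    rw [differentiableAt_euclidean]
    intro i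
    fin_cases i
    · change DifferentiableAt ℝ (fun U : State => U 0 * U 1 / 2 + U 1) U
      fun_prop
    · change DifferentiableAt ℝ (fun U : State => U 0 - U 1 ^ 2 / 2) U
      fun_prop
  have hcomp : ∀ i : Fin 2, fderiv ℝ exampleFlux U W i =
      fderiv ℝ (fun U : State => exampleFlux U i) U W := by
    intro i
    let L : State →L[ℝ] ℝ := EuclideanSpace.proj i
    have h := L.hasFDerivAt.comp U hdiff.hasFDerivAt
    have e1 : (fun U : State => exampleFlux U i) = L ∘ exampleFlux := rfl
    rw [e1, h.fderiv]
    rfl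
  ext i
  rw [hcomp i]
  fin_cases i
  · have h : HasFDerivAt (fun U : State => U 0 * U 1 * (1 / 2) + U 1) _ U :=
      ((d₀.mul d₁).mul_const (1 / 2)).add d₁
    have e1 : (fun V : State => exampleFlux V ((fun i => i) ⟨0, by simp⟩)) =
        fun U : State => U 0 * U 1 * (1 / 2) + U 1 := by
      funext V
      simp [exampleFlux]
      ring
    rw [e1, h.fderiv]
    simp [L₀, L₁]
    ring
  · have h : HasFDerivAt (fun U : State => U 0 - U 1 * U 1 * (1 / 2)) _ U :=
      d₀.sub ((d₁.mul d₁).mul_const (1 / 2))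
    have e1 : (fun V : State => exampleFlux V ((fun i => i) ⟨1, by simp⟩)) =
        fun U : State => U 0 - U 1 * U 1 * (1 / 2) := by
      funext V
      simp [exampleFlux]
      ring
    rw [e1, h.fderiv]
    simp [L₀, L₁]
    ring

theorem isCharacteristicField_charSpeed {sg e : ℝ} (hsg : sg = 1 ∨ sg = -1) (he : e ≤ 1 / 100) :
    IsCharacteristicField exampleFlux (hyperbolicSquare e) (fun U => charSpeed sg (U 0) (U 1))
      fun U => !₂[charSpeed sg (U 0) (U 1) + U 1, 1] := by
  have hpos : ∀ U ∈ hyperbolicSquare e, 0 < discriminant (U 0) (U 1) := fun U hU =>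
    discriminant_pos he hU.1.le
  have hsm : ContDiffOn ℝ ∞ (fun U : State => charSpeed sg (U 0) (U 1)) (hyperbolicSquare e) := by
    have h1 : ContDiffOn ℝ ∞ (fun U : State => discriminant (U 0) (U 1)) (hyperbolicSquare e) := by
      unfold discriminant
      fun_prop
    have h2 := h1.sqrt fun U hU => (hpos U hU).ne'
    unfold charSpeed
    fun_prop
  refine ⟨hsm, ?_, fun U _ h => ?_, fun U hU => ?_⟩
  · rw [contDiffOn_euclidean]
    intro i
    fin_cases i
    · change ContDiffOn ℝ ∞ (fun U : State => charSpeed sg (U 0) (U 1) + U 1) _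
      fun_prop
    · exact contDiffOn_const
  · have := congrArg (fun W : State => W 1) h
    simp at this
  -- Taken at its own speed the defect is zero, which is the first row of the eigenvector equation
  -- for `(Λ + v, 1)`.
  · have h := speedDefect_eq (σ := charSpeed sg (U 0) (U 1)) hsg (hpos U hU).le
    rw [sub_self, zero_mul, neg_zero, speedDefect] at h
    rw [fderiv_exampleFlux]
    ext i
    fin_cases i
    · simp
      linarith
    · simp

/-- The derivative of the speed along its eigenvector is `±3v / (2√D)`, with `D` the discriminant:
nonzero since `v > 0` on the square, yet small there. -/
theorem isGenuinelyNonlinear_charSpeed {sg e : ℝ} (hsg : sg = 1 ∨ sg = -1) (he : e ≤ 1 / 100) :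
    IsGenuinelyNonlinear (hyperbolicSquare e) (fun U => charSpeed sg (U 0) (U 1))
      fun U => !₂[charSpeed sg (U 0) (U 1) + U 1, 1] := by
  intro U hU
  have hd := discriminant_pos (v := U 1) he hU.1.le
  have hs := Real.sqrt_pos.2 hd
  let L₀ : State →L[ℝ] ℝ := EuclideanSpace.proj 0
  let L₁ : State →L[ℝ] ℝ := EuclideanSpace.proj 1
  have d₀ : HasFDerivAt (fun U : State => U 0) L₀ U := L₀.hasFDerivAt
  have d₁ : HasFDerivAt (fun U : State => U 1) L₁ U := L₁.hasFDerivAt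
  have hD : HasFDerivAt (fun U : State => U 1 * U 1 * (9 / 4) + U 0 * 2 + 4) _ U :=
    (((d₁.mul d₁).mul_const (9 / 4)).add (d₀.mul_const 2)).add_const 4
  have eD : (fun U : State => U 1 * U 1 * (9 / 4) + U 0 * 2 + 4) =
      fun U : State => discriminant (U 0) (U 1) := by
    funext V
    rw [discriminant]
    ring
  rw [eD] at hD
  have hΛ : HasFDerivAt (fun U : State => U 1 * (-1 / 4) +
      √(discriminant (U 0) (U 1)) * (sg / 2)) _ U :=
    (d₁.mul_const (-1 / 4)).add ((hD.sqrt hd.ne').mul_const (sg / 2))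
  have eΛ : (fun U : State => U 1 * (-1 / 4) + √(discriminant (U 0) (U 1)) * (sg / 2)) =
      fun U : State => charSpeed sg (U 0) (U 1) := by
    funext V
    rw [charSpeed]
    ring
  rw [eΛ] at hΛ
  have hval : fderiv ℝ (fun U : State => charSpeed sg (U 0) (U 1)) U
      !₂[charSpeed sg (U 0) (U 1) + U 1, 1] = sg * (3 / 2) * U 1 / √(discriminant (U 0) (U 1)) := by
    rw [hΛ.fderiv]
    have hsg2 : sg ^ 2 = 1 := by rcases hsg with rfl | rfl <;> norm_num
    simp [L₀, L₁, charSpeed]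
    field_simp
    linear_combination (8 * √(discriminant (U 0) (U 1))) * hsg2
  rw [hval]
  have h1 := hU.2.1
  rcases hsg with rfl | rfl
  · positivity
  · have : 0 < 3 / 2 * U 1 / √(discriminant (U 0) (U 1)) := by positivity
    intro h0
    have e1 : -1 * (3 / 2) * U 1 / √(discriminant (U 0) (U 1)) =
      -(3 / 2 * U 1 / √(discriminant (U 0) (U 1))) := by ring
    linarith

/-! ### Two solutions inside an arbitrary ball -/

theorem isPotentialLimit_const (a b : ℝ) : IsPotentialLimit (fun _ => a) fun _ => b := by
  intro ε hε
  refine ⟨fun _ => 0, fun _ => 0, a, b, .const 0, contDiff_const, fun z => ?_⟩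
  simp [partialX, partialT, hε.le]

theorem mem_ball_of_abs_sub_le {U W : State} {r : ℝ} (hr : 0 < r) (h0 : |U 0 - W 0| ≤ r / 3)
    (h1 : |U 1 - W 1| ≤ r / 3) : U ∈ Metric.ball W r := by
  rw [Metric.mem_ball, EuclideanSpace.dist_eq, Fin.sum_univ_two, Real.sqrt_lt' hr, Real.dist_eq,
    Real.dist_eq]
  have := pow_le_pow_left₀ (abs_nonneg _) h0 2
  have := pow_le_pow_left₀ (abs_nonneg _) h1 2
  nlinarith

theorem theorem1p5 :
    ∃ V : Set State, IsOpen V ∧ IsConnected V ∧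
      (∃ (Λm Λp : State → ℝ) (rm rp : State → State),
        IsCharacteristicField exampleFlux V Λm rm ∧
        IsCharacteristicField exampleFlux V Λp rp ∧
        (∀ U ∈ V, Λm U < Λp U) ∧
        IsGenuinelyNonlinear V Λm rm ∧
        IsGenuinelyNonlinear V Λp rp) ∧
      ∀ (c : State) (ρ : ℝ), 0 < ρ → Metric.ball c ρ ⊆ V →
        ∃ u₁ u₂ : ℝ → UnitAddCircle → State,
          IsContinuousInto (Metric.ball c ρ) u₁ ∧
          IsContinuousInto (Metric.ball c ρ) u₂ ∧
          IsWeakSolution exampleFlux u₁ (u₁ 0) ∧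
          IsWeakSolution exampleFlux u₂ (u₂ 0) ∧
          u₁ 0 = u₂ 0 ∧
          ∃ t : ℝ, 0 ≤ t ∧ ∃ x : UnitAddCircle, u₁ t x ≠ u₂ t x := by
  -- The side is `e / 8` for `e = 1/100000`, as the construction requires of the base state. That
  -- state is the centre of the ball, and the second solution is kept near it by choosing the
  -- displacement at most a third of the radius; it need not be near the boundary of the square.
  have he : (1 : ℝ) / 800000 ≤ 1 / 100 := by norm_num
  refine ⟨hyperbolicSquare (1 / 800000), isOpen_hyperbolicSquare _,
    isConnected_hyperbolicSquare (by norm_num),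
    ⟨_, _, _, _, isCharacteristicField_charSpeed (Or.inr rfl) he,
      isCharacteristicField_charSpeed (Or.inl rfl) he, fun U hU => ?_,
      isGenuinelyNonlinear_charSpeed (Or.inr rfl) he,
      isGenuinelyNonlinear_charSpeed (Or.inl rfl) he⟩, fun c r hr hball => ?_⟩
  · have := Real.sqrt_pos.2 (discriminant_pos (v := U 1) he hU.1.le)
    simp only [charSpeed]
    linarith
  · have hc := hball (Metric.mem_ball_self hr)
    have hc₁ : |c 1| ≤ 1 / 800000 := by
      rw [abs_of_pos hc.2.1]
      exact hc.2.2.le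
    obtain ⟨X, Y, hX, hY, pX, pY, hvan, hclose, ⟨x₀, hx₀⟩, lim₁, lim₂⟩ :=
      exists_nonconstant_flow (c₁ := c 0) (c₂ := c 1) (e := 1 / 100000) (r := r / 3) (by norm_num)
        le_rfl (by linarith [hc.1]) (by linarith) (by linarith)
    have hper : ∀ t, Function.Periodic (fun x : ℝ => (!₂[X (t, x), Y (t, x)] : State)) 1 :=
      fun t x => by simp only [pX, pY]
    let u₂ : ℝ → UnitAddCircle → State := fun t => (hper t).lift
    have hu₂ : ∀ t (x : ℝ), u₂ t x = !₂[X (t, x), Y (t, x)] := fun t x => (hper t).lift_coe x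
    have hu₁ : ∀ (t : ℝ) (x : ℝ), (fun (_ : ℝ) (_ : UnitAddCircle) => c) t x =
        !₂[(fun _ : ℝ × ℝ => c 0) (t, x), (fun _ : ℝ × ℝ => c 1) (t, x)] := fun t x => by
      ext i
      fin_cases i <;> rfl
    have hmem : ∀ t x, u₂ t x ∈ Metric.ball c r := fun t x => by
      obtain ⟨y, rfl⟩ := QuotientAddGroup.mk_surjective x
      rw [hu₂]
      exact mem_ball_of_abs_sub_le hr (hclose (t, y)).1 (hclose (t, y)).2
    have hnorm : ∀ t x, ‖u₂ t x‖ ≤ ‖c‖ + r := fun t x => by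
      have := hmem t x
      rw [Metric.mem_ball, dist_eq_norm] at this
      have h2 := norm_add_le c (u₂ t x - c)
      rw [add_sub_cancel] at h2
      linarith
    -- The constant solution is compared with the constructed one: they agree at `t = 0`, which lies
    -- outside the slab `|t - 3| ≤ 2`, and differ at `t = 3`.
    refine ⟨fun _ _ => c, u₂, ⟨continuousOn_const, fun _ _ _ => Metric.mem_ball_self hr⟩,
      ⟨(continuous_of_lift hX hY hu₂).continuousOn, fun t _ x => hmem t x⟩,
      isWeakSolution_of_lift continuous_const continuous_const hu₁ (C := ‖c‖) (fun _ _ => le_rfl)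
        (isPotentialLimit_const _ _) (isPotentialLimit_const _ _),
      isWeakSolution_of_lift hX hY hu₂ hnorm lim₁ lim₂, ?_, 3, by norm_num, x₀, ?_⟩
    · funext x
      obtain ⟨y, rfl⟩ := QuotientAddGroup.mk_surjective x
      have h := hvan (0, y) (by norm_num)
      rw [hu₂, h.1, h.2]
      ext i
      fin_cases i <;> rfl
    · rw [hu₂]
      intro h
      apply hx₀
      have := congrArg (fun W : State => W 0) h
      simpa using this.symm
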